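/- Let $E$ be a real or complex Banach space and $0\le S\le T$. Let $(A_t)_{t\in[S,T]}$ be a family of generators of strongly continuous semigroups $(e^{aA_t})_{a\ge 0}$ on $E$ which commute pairwise, i.e. $e^{aA_r}e^{bA_t}=e^{bA_t}e^{aA_r}$ for all $r,t\in[S,T]$, $a,b\ge 0$, and which is (Kato-)stable, i.e. there are $M\ge 1$ and $\omega\in\mathbb R$ such that $(\omega,\infty)\subset\rho(A_t)$ for all $t\in[S,T]$ and $\|(\lambda-A_{t_k})^{-1}\cdots(\lambda-A_{t_1})^{-1}\|\le M(\lambda-\omega)^{-k}$ for all $\lambda>\omega$ and all finite sequences $S\le t_1\le\dots\le t_k\le T$. Let $U(s,t)\in\mathcal L(E)$, $S\le s\le t\le T$, be a backward propagator, i.e. $U(s,s)=I$ and $U(s,t)=U(s,\tau)U(\tau,t)$ for $S\le s\le\tau\le t\le T$, with left generators $A_t$: for $t\in(S,T]$, $D(A_t)$ consists of all $x\in E$ for which $\lim_{h\downarrow 0}(U(t-h,t)x-x)/h$ exists, and $A_tx$ is this limit. Let $Q_{t_1,t_2}$, $S\le t_1\le t_2\le T$, be linear contractions on $E$ (operators of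 norm at most $1$). Assume: 1. $\bigcap_{t\in[S,T]}D(A_t)$ is dense in $E$. 2. There is a Banach space $Y$ which is a dense linear subspace of $E$, with $Y\subset\bigcap_{t\in[S,T]}D(A_t)$ and $U(s,t)Y\subset Y$ for all $S\le s<t\le T$, and there is $\gamma>0$ such that $\|x\|_Y\ge\gamma\,[\,\|x\|_E+\sup_{\tau\in[S,T]}\|A_\tau x\|_E\,]$ for all $x\in Y$. 3. For all $x\in Y$ and $t\in[S,T]$, the function $[S,t]\to Y$, $\tau\mapsto U(\tau,t)x$, is continuous. 4. For all $x\in Y$, the function $[S,T]\to E$, $t\mapsto A_tx$, is continuous. 5. For all $x\in Y$, $\lim_{h\downarrow 0}(Q_{t-h,t}x-x)/h=A_tx$ in $E$, uniformly in $t$ (over those $t$ and $h$ for which $S\le t-h<t\le T$). Then for all $S\le s\le t\le T$ the operator $x\mapsto\int_s^tA_rx\,dr$ with domain $Y$ is closable, its closure, denoted by $\int_s^tA_r\,dr$, generates a strongly continuous semigroup $\bigl(e^{a\int_s^tA_r\,dr}\bigr)_{a\ge0}$, and, for every sequence of partitions $\{s=t_0<t_1<\dots<t_n=t\}$ of $[s,t]$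 whose mesh $\max_j(t_{j+1}-t_j)$ tends to $0$ and for every $x\in E$, $$Q_{t_0,t_1}Q_{t_1,t_2}\cdots Q_{t_{n-1},t_n}x\;\longrightarrow\; e^{\int_s^tA_r\,dr}\,x .$$ -/

import Mathlib

open Set Filter Topology MeasureTheory
open scoped NNReal

namespace ChernoffProducts

section Operators

variable {𝕜 E : Type*} [RCLike 𝕜] [NormedAddCommGroup E] [NormedSpace 𝕜 E]

open Classical in
/-- The value `A x` of an unbounded operator at a point `x` of its domain
(and `0` at a point outside the domain). -/
noncomputable def ap (A : E →ₗ.[𝕜] E) (x : E) : E :=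
  if h : x ∈ A.domain then A ⟨x, h⟩ else 0

theorem ap_of_mem (A : E →ₗ.[𝕜] E) {x : E} (h : x ∈ A.domain) : ap A x = A ⟨x, h⟩ :=
  dif_pos h

/-- `V` is a strongly continuous semigroup (`C₀`-semigroup) of bounded operators. -/
structure IsC0Semigroup (V : ℝ≥0 → E →L[𝕜] E) : Prop where
  zero : V 0 = 1
  add : ∀ a b : ℝ≥0, V (a + b) = V a * V b
  continuous : ∀ x : E, Continuous fun a => V a x

/-- `U(s,t)`, `S ≤ s ≤ t ≤ T`, is a backward propagator. -/
structure IsBackwardPropagator (S T : ℝ) (U : ℝ → ℝ → E →L[𝕜] E) : Prop where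
  comp : ∀ s τ t : ℝ, S ≤ s → s ≤ τ → τ ≤ t → t ≤ T → U s t = U s τ * U τ t
  refl : ∀ s ∈ Icc S T, U s s = 1

variable [NormedSpace ℝ E]

/-- The (unbounded) operator `A` is the generator of the `C₀`-semigroup `V`: the pair `(x, y)`
belongs to the graph of `A` exactly if `(V(h)x - x)/h → y` as `h ↓ 0`. -/
structure IsGenerator (A : E →ₗ.[𝕜] E) (V : ℝ≥0 → E →L[𝕜] E) : Prop where
  semigroup : IsC0Semigroup V
  graph : ∀ x y : E, (x, y) ∈ A.graph ↔
    Tendsto (fun h : ℝ≥0 => (h : ℝ)⁻¹ • (V h x - x)) (𝓝[>] 0) (𝓝 y)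

/-- `A` is the left generator at time `t` of `U`: the pair `(x, y)` belongs to the graph of `A`
exactly if `(U(t-h,t)x - x)/h → y` as `h ↓ 0`. -/
def IsLeftGenerator (U : ℝ → ℝ → E →L[𝕜] E) (t : ℝ) (A : E →ₗ.[𝕜] E) : Prop :=
  ∀ x y : E, (x, y) ∈ A.graph ↔
    Tendsto (fun h : ℝ => h⁻¹ • (U (t - h) t x - x)) (𝓝[>] 0) (𝓝 y)

/-- The bounded operator `R` is the resolvent `(l - A)⁻¹` of `A` at the real point `l`. -/
structure IsResolvent (A : E →ₗ.[𝕜] E) (l : ℝ) (R : E →L[𝕜] E) : Prop where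
  right_inv : ∀ x : E, ∃ h : R x ∈ A.domain, l • R x - A ⟨R x, h⟩ = x
  left_inv : ∀ x : A.domain, R (l • (x : E) - A x) = x

/-- Kato stability of the family `A t`, `t ∈ I`: there are `M ≥ 1` and `ω` such that `(ω, ∞)` is
contained in all resolvent sets and `‖R(l, A (t k)) ⋯ R(l, A (t 1))‖ ≤ M (l - ω)⁻ᵏ` for all `l > ω`
and all finite sequences `t 1 ≤ ⋯ ≤ t k` in `I`. -/
def IsStable (I : Set ℝ) (A : ℝ → E →ₗ.[𝕜] E) : Prop :=
  ∃ (M ω : ℝ) (R : ℝ → ℝ → E →L[𝕜] E), 1 ≤ M ∧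
    (∀ l > ω, ∀ t ∈ I, IsResolvent (A t) l (R l t)) ∧
    ∀ l > ω, ∀ (k : ℕ) (t : Fin k → ℝ), (∀ i, t i ∈ I) → Monotone t →
      ‖((List.ofFn fun i => R l (t i)).reverse).prod‖ ≤ M * ((l - ω) ^ k)⁻¹

variable [IsScalarTower ℝ 𝕜 E]

/-- The operator `(∫_s^t A_r dr, Y)`, that is `x ↦ ∫_s^t A_r x dr`, whose domain consists of those
`x ∈ Y` for which the integral makes sense: `x ∈ D(A_r)` for all `r` between `s` and `t`, and
`r ↦ A_r x` is integrable. -/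
noncomputable def integralOp (A : ℝ → E →ₗ.[𝕜] E) (Y : Submodule 𝕜 E) (s t : ℝ) :
    E →ₗ.[𝕜] E where
  domain :=
    { carrier := {x | x ∈ Y ∧ (∀ r ∈ uIcc s t, x ∈ (A r).domain) ∧
        IntervalIntegrable (fun r => ap (A r) x) volume s t}
      zero_mem' := by
        refine ⟨Y.zero_mem, fun r _ => (A r).domain.zero_mem, ?_⟩
        have h : (fun r => ap (A r) (0 : E)) = fun _ => 0 := by
          funext r
          rw [ap_of_mem _ (A r).domain.zero_mem]
          exact (A r).map_zero
        rw [h]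
        exact intervalIntegrable_const
      add_mem' := by
        rintro x y ⟨hx, hx', hxi⟩ ⟨hy, hy', hyi⟩
        refine ⟨Y.add_mem hx hy, fun r hr => (A r).domain.add_mem (hx' r hr) (hy' r hr), ?_⟩
        refine (hxi.add hyi).congr ?_
        intro r hr
        have hr' := uIoc_subset_uIcc hr
        simp only [ap_of_mem _ (hx' r hr'), ap_of_mem _ (hy' r hr'),
          ap_of_mem _ ((A r).domain.add_mem (hx' r hr') (hy' r hr'))]
        exact ((A r).map_add ⟨x, hx' r hr'⟩ ⟨y, hy' r hr'⟩).symm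
      smul_mem' := by
        rintro c x ⟨hx, hx', hxi⟩
        refine ⟨Y.smul_mem c hx, fun r hr => (A r).domain.smul_mem c (hx' r hr), ?_⟩
        refine (hxi.smul c).congr ?_
        intro r hr
        have hr' := uIoc_subset_uIcc hr
        simp only [Pi.smul_apply, ap_of_mem _ (hx' r hr'),
          ap_of_mem _ ((A r).domain.smul_mem c (hx' r hr'))]
        exact ((A r).map_smul c ⟨x, hx' r hr'⟩).symm }
  toFun :=
    { toFun := fun x => ∫ r in s..t, ap (A r) (x : E)
      map_add' := by
        rintro ⟨x, hx, hx', hxi⟩ ⟨y, hy, hy', hyi⟩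
        rw [← intervalIntegral.integral_add hxi hyi]
        refine intervalIntegral.integral_congr fun r hr => ?_
        simp only [Submodule.coe_add, ap_of_mem _ (hx' r hr), ap_of_mem _ (hy' r hr),
          ap_of_mem _ ((A r).domain.add_mem (hx' r hr) (hy' r hr))]
        exact (A r).map_add ⟨x, hx' r hr⟩ ⟨y, hy' r hr⟩
      map_smul' := by
        rintro c ⟨x, hx, hx', hxi⟩
        rw [RingHom.id_apply, ← intervalIntegral.integral_smul]
        refine intervalIntegral.integral_congr fun r hr => ?_
        simp only [Submodule.coe_smul, ap_of_mem _ (hx' r hr),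
          ap_of_mem _ ((A r).domain.smul_mem c (hx' r hr))]
        exact (A r).map_smul c ⟨x, hx' r hr⟩ }

end Operators

/-- A partition `s = t₀ < t₁ < ⋯ < tₙ = t`. -/
structure TimePartition (s t : ℝ) where
  n : ℕ
  pts : Fin (n + 1) → ℝ
  strictMono : StrictMono pts
  first : pts 0 = s
  last : pts (Fin.last n) = t

/-- The mesh `max_j (t_{j+1} - t_j)`. -/
noncomputable def TimePartition.mesh {s t : ℝ} (P : TimePartition s t) : ℝ :=
  ⨆ j : Fin P.n, (P.pts j.succ - P.pts j.castSucc)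

/-- The product `Q_{t₀,t₁} Q_{t₁,t₂} ⋯ Q_{tₙ₋₁,tₙ}`. -/
noncomputable def TimePartition.chernoffProduct {𝕜 E : Type*} [RCLike 𝕜] [NormedAddCommGroup E]
    [NormedSpace 𝕜 E] {s t : ℝ} (P : TimePartition s t) (Q : ℝ → ℝ → E →L[𝕜] E) : E →L[𝕜] E :=
  (List.ofFn fun j : Fin P.n => Q (P.pts j.castSucc) (P.pts j.succ)).prod

end ChernoffProducts

open ChernoffProducts

namespace ChernoffProducts

/-! The heart is one telescoping argument, `tendsto_chernoffProduct`. If `u(τ) = U(τ,t)y`, then the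
error of the product at `y` is a sum of terms `Q u(t_{j+1}) - u(t_j)`, each hit by contractions.
Each term is `o(t_{j+1} - t_j)` uniformly, because `Q` and `U` have the same left derivative and the
orbit `u` is compact in `Y`; Banach-Steinhaus makes the consistency of `Q` uniform on compact sets.

This is used three times. With the given `Q` it shows that the products tend to `U(s,t)`, so `U` is
contractive. With the graph of `A_t` in the role of `Y` and `U(t-h,t)` in the role of `Q` it gives
`U(t-c/n,t)^n → e^{cA_t}`, so the semigroups at times `t > S` are contractive. With `e^{hA_t}` in
the role of `Q` it shows that products of the semigroups also tend to `U(s,t)`, so `U` commutes with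
all of them.

It remains to identify `U(s,t)` as `e^{∫A_r dr}`. The products of rescaled semigroups over a
partition are commuting contraction semigroups whose generators on `Y` are Riemann sums of `∫A_r
dr`. Commutativity bounds their difference by the difference of the generators, so they converge to
a semigroup `V` with `V 1 = U(s,t)` (`exists_limit_semigroup`). Finally `Y` is a core for the
generator of `V` (`isGenerator_closure`): `U(p,q)` preserves `Y` and commutes with `V`, hence
preserves the graph of `∫A_r dr` on `Y`; strong limits carry this over to the semigroups and to `V`,
for the closed graph. -/

theorem tendsto_nhdsGT_zero_iff {F : Type*} [NormedAddCommGroup F] {g : ℝ → F} {p : F} :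
    Tendsto g (𝓝[>] 0) (𝓝 p) ↔ ∀ ε > 0, ∃ δ > 0, ∀ h, 0 < h → h < δ → ‖g h - p‖ < ε := by
  rw [Metric.tendsto_nhdsWithin_nhds]
  refine forall₂_congr fun ε _ => exists_congr fun δ => and_congr_right fun _ => ?_
  constructor
  · intro H h h0 hδ
    have := @H h h0 (by rwa [Real.dist_eq, sub_zero, abs_of_pos h0])
    rwa [dist_eq_norm] at this
  · intro H h h0 hδ
    rw [dist_eq_norm]
    rw [Real.dist_eq, sub_zero, abs_of_pos h0] at hδ
    exact H h h0 hδ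

theorem hasDerivWithinAt_Ici_of_tendsto {F : Type*} [NormedAddCommGroup F] [NormedSpace ℝ F]
    {f : ℝ → F} {x : ℝ} {p : F}
    (H : Tendsto (fun h : ℝ => h⁻¹ • (f (x + h) - f x)) (𝓝[>] 0) (𝓝 p)) :
    HasDerivWithinAt f p (Ici x) x := by
  rw [← hasDerivWithinAt_Ioi_iff_Ici, hasDerivWithinAt_iff_tendsto_slope' (by simp)]
  have h2 : Tendsto (fun y : ℝ => y - x) (𝓝[>] x) (𝓝[>] 0) := by
    refine tendsto_nhdsWithin_iff.2 ⟨?_, ?_⟩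
    · have : Tendsto (fun y : ℝ => y - x) (𝓝 x) (𝓝 (x - x)) := by
        exact (continuous_id.sub continuous_const).tendsto x
      rw [sub_self] at this
      exact this.mono_left nhdsWithin_le_nhds
    · filter_upwards [self_mem_nhdsWithin] with y hy
      simpa using hy
  refine (H.comp h2).congr fun y => ?_
  simp [slope_def_module]

/-! ### Contraction semigroups and their derivatives at zero -/

section Semigroups

variable {𝕜 E : Type*} [RCLike 𝕜] [NormedAddCommGroup E] [NormedSpace 𝕜 E]

theorem norm_apply_le {X : E →L[𝕜] E} (hX : ‖X‖ ≤ 1) (x : E) : ‖X x‖ ≤ ‖x‖ :=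
  (X.le_of_opNorm_le hX x).trans_eq (one_mul _)

theorem norm_mul_le_one {X Z : E →L[𝕜] E} (hX : ‖X‖ ≤ 1) (hZ : ‖Z‖ ≤ 1) : ‖X * Z‖ ≤ 1 :=
  (norm_mul_le X Z).trans (mul_le_one₀ hX (norm_nonneg _) hZ)

theorem norm_le_one_of_tendsto {X : ℕ → E →L[𝕜] E} {Z : E →L[𝕜] E} (hX : ∀ n, ‖X n‖ ≤ 1)
    (h : ∀ x, Tendsto (fun n => X n x) atTop (𝓝 (Z x))) : ‖Z‖ ≤ 1 :=
  Z.opNorm_le_bound zero_le_one fun x => by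
    rw [one_mul]
    exact le_of_tendsto (h x).norm (Eventually.of_forall fun n => norm_apply_le (hX n) x)

theorem tendsto_of_dense {X : ℕ → E →L[𝕜] E} {Z : E →L[𝕜] E} (hX : ∀ n, ‖X n‖ ≤ 1)
    {D : Set E} (hD : Dense D) (h : ∀ x ∈ D, Tendsto (fun n => X n x) atTop (𝓝 (Z x))) (x : E) :
    Tendsto (fun n => X n x) atTop (𝓝 (Z x)) := by
  -- The three errors of the approximation carry the factors `1`, `1` and `‖Z‖`.
  have hC : 0 < 2 + ‖Z‖ := by positivity
  rw [Metric.tendsto_atTop]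
  intro ε hε
  obtain ⟨y, hy, hxy⟩ := Metric.dense_iff.1 hD x (ε / (2 + ‖Z‖)) (by positivity)
  rw [Metric.mem_ball, dist_eq_norm] at hy
  obtain ⟨N, hN⟩ := Metric.tendsto_atTop.1 (h y hxy) (ε / (2 + ‖Z‖)) (by positivity)
  refine ⟨N, fun n hn => ?_⟩
  have h1 := hN n hn
  rw [dist_eq_norm] at h1 ⊢
  have h2 : X n x - Z x = -(X n (y - x)) + (X n y - Z y) + Z (y - x) := by
    simp only [map_sub]; abel
  have h3 := norm_apply_le (hX n) (y - x)
  have h4 := Z.le_opNorm (y - x)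
  have h5 : ‖Z‖ * ‖y - x‖ ≤ ‖Z‖ * (ε / (2 + ‖Z‖)) := by gcongr
  have h6 : ‖X n x - Z x‖ ≤ ‖X n (y - x)‖ + ‖X n y - Z y‖ + ‖Z (y - x)‖ := by
    rw [h2]
    refine (norm_add_le _ _).trans (add_le_add_left ((norm_add_le _ _).trans ?_) _)
    rw [norm_neg]
  have h7 : ε / (2 + ‖Z‖) + ε / (2 + ‖Z‖) + ‖Z‖ * (ε / (2 + ‖Z‖)) = ε := by
    field_simp
    ring
  linarith

theorem commute_of_tendsto {X : ℕ → E →L[𝕜] E} {Z K : E →L[𝕜] E}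
    (h : ∀ x, Tendsto (fun n => X n x) atTop (𝓝 (Z x))) (hK : ∀ n, Commute (X n) K) :
    Commute Z K := by
  ext x
  have h1 : Tendsto (fun n => K (X n x)) atTop (𝓝 (K (Z x))) := (K.continuous.tendsto _).comp (h x)
  refine tendsto_nhds_unique (h (K x)) (h1.congr fun n => ?_)
  exact (DFunLike.congr_fun (hK n).eq x).symm

/-- Telescoping for powers of commuting contractions. -/
theorem norm_pow_sub_pow_le {X Z : E →L[𝕜] E} (hX : ‖X‖ ≤ 1) (hZ : ‖Z‖ ≤ 1)
    (hXZ : Commute X Z) (n : ℕ) (x : E) :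
    ‖(X ^ n) x - (Z ^ n) x‖ ≤ n * ‖X x - Z x‖ := by
  have hpow : ∀ n : ℕ, ‖X ^ n‖ ≤ 1 := fun n => by
    induction n with
    | zero => rw [pow_zero]; exact ContinuousLinearMap.norm_id_le
    | succ n ih => rw [pow_succ]; exact norm_mul_le_one ih hX
  induction n with
  | zero => simp
  | succ n ih =>
    have e : (X ^ (n + 1)) x - (Z ^ (n + 1)) x
        = (X ^ n) (X x - Z x) + Z ((X ^ n) x - (Z ^ n) x) := by
      have e1 : (X ^ n) (Z x) = Z ((X ^ n) x) := DFunLike.congr_fun (hXZ.pow_left n).eq x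
      have e2 : (X ^ (n + 1)) x = (X ^ n) (X x) := by rw [pow_succ]; rfl
      have e3 : (Z ^ (n + 1)) x = Z ((Z ^ n) x) := by rw [pow_succ']; rfl
      rw [map_sub, map_sub, e1, e2, e3]
      abel
    rw [e]
    have h1 := norm_apply_le (hpow n) (X x - Z x)
    have h2 := norm_apply_le hZ ((X ^ n) x - (Z ^ n) x)
    have h3 := norm_add_le ((X ^ n) (X x - Z x)) (Z ((X ^ n) x - (Z ^ n) x))
    rw [Nat.cast_succ, add_one_mul]
    exact h3.trans (by linarith)

theorem IsC0Semigroup.commute {V : ℝ≥0 → E →L[𝕜] E} (hV : IsC0Semigroup V) (a b : ℝ≥0) :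
    Commute (V a) (V b) := by
  rw [Commute, SemiconjBy, ← hV.add, ← hV.add, add_comm]

theorem IsC0Semigroup.map_nsmul {V : ℝ≥0 → E →L[𝕜] E} (hV : IsC0Semigroup V) (n : ℕ) (a : ℝ≥0) :
    V (n • a) = V a ^ n := by
  induction n with
  | zero => simp [hV.zero]
  | succ n ih => rw [succ_nsmul, hV.add, ih, pow_succ]

theorem isC0Semigroup_one : IsC0Semigroup (fun _ : ℝ≥0 => (1 : E →L[𝕜] E)) where
  zero := rfl
  add _ _ := (one_mul 1).symm
  continuous _ := continuous_const

theorem IsC0Semigroup.rescale {V : ℝ≥0 → E →L[𝕜] E} (hV : IsC0Semigroup V) (c : ℝ≥0) :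
    IsC0Semigroup (fun a => V (a * c)) where
  zero := by simp [hV.zero]
  add a b := by rw [add_mul, hV.add]
  continuous x := (hV.continuous x).comp (continuous_mul_const c)

theorem tendsto_apply_of_contraction {ι : Type*} {l : Filter ι} {X : ι → E →L[𝕜] E}
    (hX : ∀ j, ‖X j‖ ≤ 1) {f : ι → E} {p q : E} (hf : Tendsto f l (𝓝 p))
    (hp : Tendsto (fun j => X j p) l (𝓝 q)) : Tendsto (fun j => X j (f j)) l (𝓝 q) := by
  have h0 : Tendsto (fun j => X j (f j - p)) l (𝓝 0) := by
    refine squeeze_zero_norm (fun j => norm_apply_le (hX j) _) ?_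
    simpa using (hf.sub_const p).norm
  simpa using h0.add hp

theorem IsC0Semigroup.mul {V W : ℝ≥0 → E →L[𝕜] E} (hV : IsC0Semigroup V)
    (hV1 : ∀ a, ‖V a‖ ≤ 1) (hW : IsC0Semigroup W) (hVW : ∀ a b, Commute (V a) (W b)) :
    IsC0Semigroup (fun a => V a * W a) where
  zero := by simp [hV.zero, hW.zero]
  add a b := by
    rw [hV.add, hW.add, mul_assoc, mul_assoc, ← mul_assoc (V b), (hVW b a).eq, mul_assoc]
  continuous x := by
    rw [continuous_iff_continuousAt]
    intro a
    exact tendsto_apply_of_contraction hV1 ((hW.continuous x).tendsto a)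
      ((hV.continuous _).tendsto a)

theorem IsC0Semigroup.continuous_real {V : ℝ≥0 → E →L[𝕜] E} (hV : IsC0Semigroup V) (x : E) :
    Continuous fun r : ℝ => V r.toNNReal x :=
  (hV.continuous x).comp continuous_real_toNNReal

variable [NormedSpace ℝ E]

/-- `p` is the derivative at `0` of the orbit `h ↦ V(h)x`. -/
def HasDerivAtZero (V : ℝ≥0 → E →L[𝕜] E) (x p : E) : Prop :=
  Tendsto (fun h : ℝ≥0 => (h : ℝ)⁻¹ • (V h x - x)) (𝓝[>] 0) (𝓝 p)

theorem tendsto_toNNReal_nhdsGT_zero :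
    Tendsto Real.toNNReal (𝓝[>] (0 : ℝ)) (𝓝[>] (0 : ℝ≥0)) := by
  refine tendsto_nhdsWithin_iff.2 ⟨?_, ?_⟩
  · have : Tendsto Real.toNNReal (𝓝 0) (𝓝 (Real.toNNReal 0)) := continuous_real_toNNReal.tendsto 0
    rw [Real.toNNReal_zero] at this
    exact this.mono_left nhdsWithin_le_nhds
  · filter_upwards [self_mem_nhdsWithin] with y hy
    simpa using hy

theorem tendsto_coe_nhdsGT_zero :
    Tendsto (fun h : ℝ≥0 => (h : ℝ)) (𝓝[>] (0 : ℝ≥0)) (𝓝[>] (0 : ℝ)) := by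
  refine tendsto_nhdsWithin_iff.2 ⟨?_, ?_⟩
  · have : Tendsto (fun h : ℝ≥0 => (h : ℝ)) (𝓝 0) (𝓝 ((0 : ℝ≥0) : ℝ)) :=
      NNReal.continuous_coe.tendsto 0
    exact this.mono_left nhdsWithin_le_nhds
  · filter_upwards [self_mem_nhdsWithin] with y hy
    simpa using hy

theorem hasDerivAtZero_iff_real {V : ℝ≥0 → E →L[𝕜] E} {x p : E} :
    HasDerivAtZero V x p ↔
      Tendsto (fun h : ℝ => h⁻¹ • (V h.toNNReal x - x)) (𝓝[>] 0) (𝓝 p) := by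
  constructor
  · intro H
    refine (H.comp tendsto_toNNReal_nhdsGT_zero).congr' ?_
    filter_upwards [self_mem_nhdsWithin] with y hy
    simp [Real.coe_toNNReal y (le_of_lt hy)]
  · intro H
    refine (H.comp tendsto_coe_nhdsGT_zero).congr fun y => ?_
    simp

theorem hasDerivAtZero_iff_eps {V : ℝ≥0 → E →L[𝕜] E} {x p : E} :
    HasDerivAtZero V x p ↔ ∀ ε > 0, ∃ δ > 0, ∀ h : ℝ, 0 < h → h < δ →
      ‖h⁻¹ • (V h.toNNReal x - x) - p‖ < ε := by
  rw [hasDerivAtZero_iff_real, tendsto_nhdsGT_zero_iff]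

theorem hasDerivAtZero_one (x : E) : HasDerivAtZero (fun _ : ℝ≥0 => (1 : E →L[𝕜] E)) x 0 := by
  refine tendsto_const_nhds.congr fun h => ?_
  simp

theorem HasDerivAtZero.rescale {V : ℝ≥0 → E →L[𝕜] E} (hV : IsC0Semigroup V) {x p : E}
    (H : HasDerivAtZero V x p) (c : ℝ≥0) :
    HasDerivAtZero (fun a => V (a * c)) x ((c : ℝ) • p) := by
  rcases eq_or_ne c 0 with rfl | hc
  · refine tendsto_const_nhds.congr fun h => ?_
    simp [hV.zero]
  · have h1 : Tendsto (fun h : ℝ≥0 => h * c) (𝓝[>] 0) (𝓝[>] 0) := by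
      refine tendsto_nhdsWithin_iff.2 ⟨?_, ?_⟩
      · have : Tendsto (fun h : ℝ≥0 => h * c) (𝓝 0) (𝓝 (0 * c)) :=
          (continuous_mul_const c).tendsto 0
        rw [zero_mul] at this
        exact this.mono_left nhdsWithin_le_nhds
      · filter_upwards [self_mem_nhdsWithin] with y hy
        exact mul_pos hy (pos_iff_ne_zero.2 hc)
    refine ((H.comp h1).const_smul (c : ℝ)).congr fun h => ?_
    have hc' : (c : ℝ) ≠ 0 := by exact_mod_cast hc
    simp only [Function.comp_apply, NNReal.coe_mul, smul_smul, mul_inv]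
    congr 1
    field_simp

/-- For `a = (n+1)h`, telescoping the powers bounds the left side by `a` times the distance between
the two difference quotients at `h`; now let `n → ∞`. -/
theorem norm_semigroup_sub_le {V W : ℝ≥0 → E →L[𝕜] E} (hV : IsC0Semigroup V)
    (hV1 : ∀ a, ‖V a‖ ≤ 1) (hW : IsC0Semigroup W) (hW1 : ∀ a, ‖W a‖ ≤ 1)
    (hVW : ∀ a b, Commute (V a) (W b)) {x p q : E} (hp : HasDerivAtZero V x p)
    (hq : HasDerivAtZero W x q) (a : ℝ≥0) : ‖V a x - W a x‖ ≤ a * ‖p - q‖ := by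
  rcases eq_or_ne a 0 with rfl | ha
  · simp [hV.zero, hW.zero]
  have ht : Tendsto (fun n : ℕ => a / ((n : ℝ≥0) + 1)) atTop (𝓝[>] 0) := by
    refine tendsto_nhdsWithin_iff.2 ⟨?_, Eventually.of_forall fun n => ?_⟩
    · have := (tendsto_one_div_add_atTop_nhds_zero_nat (𝕜 := ℝ≥0)).const_mul a
      rw [mul_zero] at this
      exact this.congr fun n => by rw [mul_one_div]
    · exact div_pos (pos_iff_ne_zero.2 ha) (by positivity)
  have h1 := (((hp.sub hq).comp ht).norm).const_mul (a : ℝ)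
  refine ge_of_tendsto h1 (Eventually.of_forall fun n => ?_)
  set h : ℝ≥0 := a / ((n : ℝ≥0) + 1) with hh
  have e : a = (n + 1) • h := by
    rw [hh, nsmul_eq_mul]; push_cast; field_simp
  have hpos : 0 < (h : ℝ) := by
    have : 0 < h := div_pos (pos_iff_ne_zero.2 ha) (by positivity)
    exact_mod_cast this
  have h2 := norm_pow_sub_pow_le (hV1 h) (hW1 h) (hVW h h) (n + 1) x
  rw [← hV.map_nsmul, ← hW.map_nsmul, ← e] at h2
  refine h2.trans_eq ?_
  have e' : (a : ℝ) = (n + 1 : ℕ) * (h : ℝ) := by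
    conv_lhs => rw [e]
    simp
  simp only [Function.comp_apply, ← smul_sub, ← hh]
  rw [norm_smul, norm_inv, Real.norm_of_nonneg hpos.le, e', mul_assoc, mul_inv_cancel_left₀ hpos.ne']
  congr 2
  abel

variable [IsScalarTower ℝ 𝕜 E]

theorem HasDerivAtZero.map {V : ℝ≥0 → E →L[𝕜] E} {x p : E} (H : HasDerivAtZero V x p)
    {X : E →L[𝕜] E} (hX : ∀ a, Commute (V a) X) : HasDerivAtZero V (X x) (X p) := by
  refine ((X.continuous.tendsto p).comp H).congr fun h => ?_
  have e : V h (X x) = X (V h x) := DFunLike.congr_fun (hX h).eq x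
  rw [Function.comp_apply, ContinuousLinearMap.map_smul_of_tower, map_sub, e]

theorem HasDerivAtZero.mul {V W : ℝ≥0 → E →L[𝕜] E} (hV : IsC0Semigroup V)
    (hV1 : ∀ a, ‖V a‖ ≤ 1) {x p q : E}
    (h₁ : HasDerivAtZero V x p) (h₂ : HasDerivAtZero W x q) :
    HasDerivAtZero (fun a => V a * W a) x (p + q) := by
  have h3 : Tendsto (fun h : ℝ≥0 => V h q) (𝓝[>] 0) (𝓝 q) := by
    have := (hV.continuous q).tendsto 0
    rw [hV.zero] at this
    exact this.mono_left nhdsWithin_le_nhds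
  refine (h₁.add (tendsto_apply_of_contraction hV1 h₂ h3)).congr fun h => ?_
  rw [ContinuousLinearMap.map_smul_of_tower, ← smul_add, map_sub]
  change _ = (h : ℝ)⁻¹ • (V h (W h x) - x)
  congr 1
  abel

/-- A product of commuting contraction semigroups is a contraction semigroup, and the derivatives
at zero add up. -/
theorem semigroup_prod {n : ℕ} (V : Fin n → ℝ≥0 → E →L[𝕜] E) (hV : ∀ j, IsC0Semigroup (V j))
    (hV1 : ∀ j a, ‖V j a‖ ≤ 1) (hcomm : ∀ j k a b, Commute (V j a) (V k b)) :
    IsC0Semigroup (fun a => (List.ofFn fun j => V j a).prod) ∧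
    (∀ a, ‖(List.ofFn fun j => V j a).prod‖ ≤ 1) ∧
    ∀ (x : E) (p : Fin n → E), (∀ j, HasDerivAtZero (V j) x (p j)) →
      HasDerivAtZero (fun a => (List.ofFn fun j => V j a).prod) x (∑ j, p j) := by
  induction n with
  | zero =>
    refine ⟨by simpa using isC0Semigroup_one, fun a => ?_, fun x p _ => ?_⟩
    · simp only [List.ofFn_zero, List.prod_nil]; exact ContinuousLinearMap.norm_id_le
    · simpa using hasDerivAtZero_one x
  | succ n ih =>
    obtain ⟨i1, i2, i3⟩ := ih (fun j => V j.succ) (fun j => hV _) (fun j => hV1 _)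
      (fun j k => hcomm _ _)
    simp only [List.ofFn_succ, List.prod_cons]
    refine ⟨(hV 0).mul (hV1 0) i1 fun a b => ?_, fun a => norm_mul_le_one (hV1 0 a) (i2 a),
      fun x p hp => ?_⟩
    · refine Commute.list_prod_right _ _ fun X hX => ?_
      obtain ⟨j, rfl⟩ := (List.mem_ofFn' _ _).1 hX
      exact hcomm _ _ _ _
    · rw [Fin.sum_univ_succ]
      exact (hp 0).mul (hV 0) (hV1 0) (i3 x _ fun j => hp _)

theorem HasDerivAtZero.hasDerivWithinAt {V : ℝ≥0 → E →L[𝕜] E} (hV : IsC0Semigroup V) {x p : E}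
    (H : HasDerivAtZero V x p) {r : ℝ} (hr : 0 ≤ r) :
    HasDerivWithinAt (fun r : ℝ => V r.toNNReal x) (V r.toNNReal p) (Ici r) r := by
  apply hasDerivWithinAt_Ici_of_tendsto
  refine (((V r.toNNReal).continuous.tendsto p).comp (hasDerivAtZero_iff_real.1 H)).congr' ?_
  filter_upwards [self_mem_nhdsWithin] with h hh
  rw [Real.toNNReal_add hr (le_of_lt hh), hV.add, Function.comp_apply,
    ContinuousLinearMap.map_smul_of_tower, map_sub]
  rfl

/-- The function `r ↦ V(r)x - r q` has right derivative `V(r)p - q = (V(r)q - q) + V(r)(p - q)`. The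
vector `q` is independent of `x`, so that it can stay fixed while `(x, p)` varies in a graph; `q =
0` gives the Lipschitz bound for orbits. -/
theorem norm_increment_sub_le {V : ℝ≥0 → E →L[𝕜] E} (hV : IsC0Semigroup V)
    (hV1 : ∀ a, ‖V a‖ ≤ 1) {x p q : E} (H : HasDerivAtZero V x p) {ε h : ℝ} (hh : 0 ≤ h)
    (hε : ∀ r : ℝ, 0 ≤ r → r ≤ h → ‖V r.toNNReal q - q‖ ≤ ε) :
    ‖V h.toNNReal x - x - h • q‖ ≤ h * (ε + ‖p - q‖) := by
  have h1 := norm_image_sub_le_of_norm_deriv_right_le_segment (a := 0) (b := h)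
    (f := fun r : ℝ => V r.toNNReal x - r • q) (f' := fun r => V r.toNNReal p - q)
    (C := ε + ‖p - q‖) ?_ ?_ ?_ h ⟨hh, le_rfl⟩
  · simp only [Real.toNNReal_zero, hV.zero, zero_smul, sub_zero, one_apply_eq_self]
      at h1
    rw [mul_comm]
    refine le_trans (le_of_eq ?_) h1
    congr 1
    abel
  · exact ((hV.continuous_real x).sub (continuous_id.smul continuous_const)).continuousOn
  · intro r hr
    have h2 : HasDerivWithinAt (fun r : ℝ => r • q) ((1 : ℝ) • q) (Ici r) r :=
      (hasDerivWithinAt_id r _).smul_const q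
    rw [one_smul] at h2
    exact (H.hasDerivWithinAt hV hr.1).sub h2
  · intro r hr
    have e : V r.toNNReal p - q = (V r.toNNReal q - q) + V r.toNNReal (p - q) := by
      rw [map_sub]; abel
    rw [e]
    exact (norm_add_le _ _).trans
      (add_le_add (hε r hr.1 hr.2.le) (norm_apply_le (hV1 _) _))

theorem norm_increment_le {V : ℝ≥0 → E →L[𝕜] E} (hV : IsC0Semigroup V)
    (hV1 : ∀ a, ‖V a‖ ≤ 1) {x p : E} (H : HasDerivAtZero V x p) {h : ℝ} (hh : 0 ≤ h) :
    ‖V h.toNNReal x - x‖ ≤ h * ‖p‖ := by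
  simpa using norm_increment_sub_le hV hV1 (q := 0) H (ε := 0) hh (by simp)

/-- For fixed `h`, the increment estimate with `q` equal to the limiting second coordinate is a
closed condition on the pair, and the admissible range of `h` depends on that `q` alone. -/
theorem hasDerivAtZero_of_mem_closure {V : ℝ≥0 → E →L[𝕜] E} (hV : IsC0Semigroup V)
    (hV1 : ∀ a, ‖V a‖ ≤ 1) {Γ : Set (E × E)} (hΓ : ∀ p ∈ Γ, HasDerivAtZero V p.1 p.2)
    {p : E × E} (hp : p ∈ closure Γ) : HasDerivAtZero V p.1 p.2 := by
  rw [hasDerivAtZero_iff_eps]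
  intro ε hε
  have hc := (hV.continuous_real p.2).tendsto 0
  rw [Real.toNNReal_zero, hV.zero] at hc
  obtain ⟨δ, hδ, h1⟩ := Metric.tendsto_nhds_nhds.1 hc (ε / 2) (by positivity)
  refine ⟨δ, hδ, fun h h0 hh => ?_⟩
  have h2 : ∀ r : ℝ, 0 ≤ r → r ≤ h → ‖V r.toNNReal p.2 - p.2‖ ≤ ε / 2 := fun r hr hrh => by
    have := @h1 r (by rw [dist_zero_right, Real.norm_of_nonneg hr]; linarith)
    rw [dist_eq_norm] at this
    exact this.le
  have hclosed : IsClosed {q : E × E |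
      ‖V h.toNNReal q.1 - q.1 - h • p.2‖ ≤ h * (ε / 2 + ‖q.2 - p.2‖)} := by
    apply isClosed_le <;> fun_prop
  have h3 : ‖V h.toNNReal p.1 - p.1 - h • p.2‖ ≤ h * (ε / 2 + ‖p.2 - p.2‖) :=
    closure_minimal (t := {q : E × E |
      ‖V h.toNNReal q.1 - q.1 - h • p.2‖ ≤ h * (ε / 2 + ‖q.2 - p.2‖)})
      (fun q hq => norm_increment_sub_le hV hV1 (hΓ q hq) h0.le h2) hclosed hp
  rw [sub_self, norm_zero, add_zero] at h3
  have h4 : h⁻¹ • (V h.toNNReal p.1 - p.1) - p.2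
      = h⁻¹ • (V h.toNNReal p.1 - p.1 - h • p.2) := by
    rw [smul_sub h⁻¹ _ (h • p.2), smul_smul, inv_mul_cancel₀ h0.ne', one_smul]
  rw [h4, norm_smul, norm_inv, Real.norm_of_nonneg h0.le, inv_mul_lt_iff₀ h0]
  nlinarith

end Semigroups

/-! ### Strong limits of commuting contraction semigroups -/

section LimitSemigroup

variable {𝕜 E : Type*} [RCLike 𝕜] [NormedAddCommGroup E] [NormedSpace 𝕜 E] [CompleteSpace E]

theorem exists_limit_of_dense {X : ℕ → E →L[𝕜] E} (hX : ∀ n, ‖X n‖ ≤ 1) {D : Set E}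
    (hD : Dense D) (h : ∀ x ∈ D, CauchySeq fun n => X n x) :
    ∃ Z : E →L[𝕜] E, ∀ x, Tendsto (fun n => X n x) atTop (𝓝 (Z x)) := by
  have hc : ∀ x, ∃ z, Tendsto (fun n => X n x) atTop (𝓝 z) := fun x => by
    refine cauchySeq_tendsto_of_complete (Metric.cauchySeq_iff'.2 fun ε hε => ?_)
    obtain ⟨y, hy, hxy⟩ := Metric.dense_iff.1 hD x (ε / 3) (by positivity)
    rw [Metric.mem_ball, dist_eq_norm] at hy
    obtain ⟨N, hN⟩ := Metric.cauchySeq_iff'.1 (h y hxy) (ε / 3) (by positivity)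
    refine ⟨N, fun n hn => ?_⟩
    have h1 := hN n hn
    rw [dist_eq_norm] at h1 ⊢
    have h2 : X n x - X N x = -(X n (y - x)) + (X n y - X N y) + X N (y - x) := by
      simp only [map_sub]; abel
    have h3 := norm_apply_le (hX n) (y - x)
    have h4 := norm_apply_le (hX N) (y - x)
    rw [h2]
    refine (norm_add₃_le).trans_lt ?_
    rw [norm_neg]
    linarith
  choose f hf using hc
  exact ⟨continuousLinearMapOfTendsto X (tendsto_pi_nhds.2 hf), hf⟩

variable [NormedSpace ℝ E] [IsScalarTower ℝ 𝕜 E]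

/-- The strong limit of commuting contraction semigroups whose generators converge pointwise on
a dense set. -/
theorem exists_limit_semigroup (W : ℕ → ℝ≥0 → E →L[𝕜] E) (hW : ∀ n, IsC0Semigroup (W n))
    (hW1 : ∀ n a, ‖W n a‖ ≤ 1) (hcomm : ∀ n m a b, Commute (W n a) (W m b))
    {D : Set E} (hD : Dense D) (B : E → E) (b : ℕ → E → E)
    (hb : ∀ n, ∀ x ∈ D, HasDerivAtZero (W n) x (b n x))
    (hB : ∀ x ∈ D, Tendsto (fun n => b n x) atTop (𝓝 (B x))) :
    ∃ V : ℝ≥0 → E →L[𝕜] E, IsC0Semigroup V ∧ (∀ a, ‖V a‖ ≤ 1) ∧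
      (∀ a x, Tendsto (fun n => W n a x) atTop (𝓝 (V a x))) ∧
      ∀ x ∈ D, HasDerivAtZero V x (B x) := by
  have hle : ∀ x ∈ D, ∀ n m a, ‖W n a x - W m a x‖ ≤ a * ‖b n x - b m x‖ := fun x hx n m a =>
    norm_semigroup_sub_le (hW n) (hW1 n) (hW m) (hW1 m) (hcomm n m) (hb n x hx) (hb m x hx) a
  have hlim : ∀ a, ∃ Z : E →L[𝕜] E, ∀ x, Tendsto (fun n => W n a x) atTop (𝓝 (Z x)) := fun a => by
    refine exists_limit_of_dense (fun n => hW1 n a) hD fun x hx => ?_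
    rw [Metric.cauchySeq_iff']
    intro ε hε
    obtain ⟨N, hN⟩ := Metric.cauchySeq_iff'.1 (hB x hx).cauchySeq (ε / (a + 1)) (by positivity)
    refine ⟨N, fun n hn => ?_⟩
    have h1 := hN n hn
    rw [dist_eq_norm] at h1 ⊢
    refine (hle x hx n N a).trans_lt ?_
    rw [lt_div_iff₀ (by positivity)] at h1
    have := norm_nonneg (b n x - b N x)
    linarith
  choose V hV using hlim
  have hV1 : ∀ a, ‖V a‖ ≤ 1 := fun a => norm_le_one_of_tendsto (fun n => hW1 n a) (hV a)
  -- The bound is linear in `a`, so it survives division by `h` in the difference quotient at zero.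
  have hVle : ∀ x ∈ D, ∀ n a, ‖W n a x - V a x‖ ≤ a * ‖b n x - B x‖ := fun x hx n a =>
    le_of_tendsto_of_tendsto' ((hV a x).const_sub _).norm
      (((hB x hx).const_sub _).norm.const_mul _) fun m => hle x hx n m a
  have hadd : ∀ a c, V (a + c) = V a * V c := fun a c => by
    ext x
    refine tendsto_nhds_unique (hV (a + c) x) ?_
    refine (tendsto_apply_of_contraction (fun n => hW1 n a) (hV c x) (hV a _)).congr fun n => ?_
    rw [(hW n).add]; rfl
  have hzero : V 0 = 1 := by
    ext x
    refine tendsto_nhds_unique (hV 0 x) (tendsto_const_nhds.congr fun n => ?_)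
    rw [(hW n).zero]
  have hlip : ∀ x ∈ D, ∀ a c, ‖V (a + c) x - V a x‖ ≤ c * ‖B x‖ := fun x hx a c => by
    have h1 : ‖V c x - x‖ ≤ c * ‖B x‖ := by
      refine le_of_tendsto_of_tendsto' ((hV c x).sub_const x).norm
        ((hB x hx).norm.const_mul _) fun n => ?_
      simpa using norm_increment_le (hW n) (hW1 n) (hb n x hx) c.2
    have h2 : V (a + c) x - V a x = V a (V c x - x) := by rw [hadd, map_sub]; rfl
    rw [h2]
    exact (norm_apply_le (hV1 a) _).trans h1
  have hcont : ∀ x ∈ D, Continuous fun a => V a x := fun x hx => by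
    refine (LipschitzWith.of_dist_le_mul (K := ‖B x‖₊) fun a c => ?_).continuous
    wlog hac : a ≤ c generalizing a c
    · rw [dist_comm, dist_comm a]
      exact this c a (le_of_not_ge hac)
    obtain ⟨d, rfl⟩ := exists_add_of_le hac
    rw [dist_comm, dist_eq_norm, mul_comm, dist_comm, NNReal.dist_eq]
    have : |((a + d : ℝ≥0) : ℝ) - a| = d := by simp
    rw [this]
    exact hlip x hx a d
  refine ⟨V, ⟨hzero, hadd, fun x => ?_⟩, hV1, hV, fun x hx => ?_⟩
  · refine continuous_of_uniform_approx_of_continuous fun u hu => ?_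
    obtain ⟨ε, hε, hεu⟩ := Metric.mem_uniformity_dist.1 hu
    obtain ⟨y, hy, hxy⟩ := Metric.dense_iff.1 hD x ε hε
    refine ⟨fun a => V a y, hcont y hxy, fun a => hεu ?_⟩
    rw [dist_eq_norm, ← map_sub]
    refine (norm_apply_le (hV1 a) _).trans_lt ?_
    rw [Metric.mem_ball, dist_comm, dist_eq_norm] at hy
    exact hy
  · rw [hasDerivAtZero_iff_eps]
    intro ε hε
    obtain ⟨n, hn⟩ := (Metric.tendsto_atTop.1 (hB x hx) (ε / 3) (by positivity))
    have hn := hn n le_rfl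
    rw [dist_eq_norm] at hn
    obtain ⟨δ, hδ, h1⟩ := hasDerivAtZero_iff_eps.1 (hb n x hx) (ε / 3) (by positivity)
    refine ⟨δ, hδ, fun h h0 hh => ?_⟩
    have h2 := h1 h h0 hh
    have h3 := hVle x hx n h.toNNReal
    rw [Real.coe_toNNReal h h0.le] at h3
    have h4 : h⁻¹ • (V h.toNNReal x - x) - B x = (h⁻¹ • (W n h.toNNReal x - x) - b n x)
        - h⁻¹ • (W n h.toNNReal x - V h.toNNReal x) + (b n x - B x) := by
      simp only [smul_sub]; abel
    have h5 : ‖h⁻¹ • (W n h.toNNReal x - V h.toNNReal x)‖ ≤ ‖b n x - B x‖ := by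
      rw [norm_smul, norm_inv, Real.norm_of_nonneg h0.le, inv_mul_le_iff₀ h0]
      exact h3
    rw [h4]
    have h6 := norm_add_le ((h⁻¹ • (W n h.toNNReal x - x) - b n x)
        - h⁻¹ • (W n h.toNNReal x - V h.toNNReal x)) (b n x - B x)
    have h7 := norm_sub_le (h⁻¹ • (W n h.toNNReal x - x) - b n x)
        (h⁻¹ • (W n h.toNNReal x - V h.toNNReal x))
    linarith

end LimitSemigroup

/-! ### A core criterion for generators -/

section Core

variable {𝕜 E : Type*} [RCLike 𝕜] [NormedAddCommGroup E] [NormedSpace 𝕜 E] [CompleteSpace E]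
  [NormedSpace ℝ E] [IsScalarTower ℝ 𝕜 E]

/-- If `(x, z) ∈ Γ`, the average of `(V(r)x, V(r)z)` over `[0, a]` lies in the closed convex set
`Γ`, and its second coordinate is `(V(a)x - x)/a` by the fundamental theorem of calculus. This form
no longer involves `z` and is continuous in `x`, so density gives all `x`. -/
theorem average_mem_of_invariant {V : ℝ≥0 → E →L[𝕜] E} (hV : IsC0Semigroup V)
    (hV1 : ∀ a, ‖V a‖ ≤ 1) (Γ : Submodule 𝕜 (E × E)) (hΓ : IsClosed (Γ : Set (E × E)))
    (hd : ∀ p ∈ Γ, HasDerivAtZero V p.1 p.2)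
    (hinv : ∀ a, ∀ p ∈ Γ, (V a p.1, V a p.2) ∈ Γ) (hdense : Dense (Prod.fst '' (Γ : Set (E × E))))
    {a : ℝ} (ha : 0 < a) (x : E) :
    (a⁻¹ • (∫ r in 0..a, V r.toNNReal x), a⁻¹ • (V a.toNNReal x - x)) ∈ Γ := by
  have hconv : Convex ℝ (Γ : Set (E × E)) := by
    intro p hp q hq c d _ _ _
    rw [RCLike.real_smul_eq_coe_smul (K := 𝕜) c p, RCLike.real_smul_eq_coe_smul (K := 𝕜) d q]
    exact Γ.add_mem (Γ.smul_mem _ hp) (Γ.smul_mem _ hq)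
  have hint : ∀ y, IntervalIntegrable (fun r : ℝ => V r.toNNReal y) volume 0 a := fun y =>
    (hV.continuous_real y).intervalIntegrable _ _
  have hcont : Continuous fun x => ∫ r in 0..a, V r.toNNReal x := by
    refine (LipschitzWith.of_dist_le_mul (K := a.toNNReal) fun y z => ?_).continuous
    rw [dist_eq_norm, dist_eq_norm, ← intervalIntegral.integral_sub (hint y) (hint z),
      Real.coe_toNNReal a ha.le, mul_comm]
    refine (intervalIntegral.norm_integral_le_of_norm_le_const fun r _ => ?_).trans_eq
      (by rw [sub_zero, abs_of_pos ha])
    rw [← map_sub]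
    exact norm_apply_le (hV1 _) _
  have hclosed : IsClosed {x : E |
      (a⁻¹ • (∫ r in 0..a, V r.toNNReal x), a⁻¹ • (V a.toNNReal x - x)) ∈ (Γ : Set (E × E))} := by
    refine hΓ.preimage ?_
    fun_prop
  refine closure_minimal ?_ hclosed (hdense x)
  rintro _ ⟨⟨x, z⟩, hxz, rfl⟩
  have hf : Continuous fun r : ℝ => (V r.toNNReal x, V r.toNNReal z) :=
    (hV.continuous_real x).prodMk (hV.continuous_real z)
  have h1 := hconv.set_average_mem (μ := volume) (t := uIoc 0 a) hΓ (by simp [uIoc_of_le ha.le, ha])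
    (by simp [uIoc_of_le ha.le]) (Eventually.of_forall fun r => hinv r.toNNReal _ hxz)
    (intervalIntegrable_iff.1 (hf.intervalIntegrable 0 a))
  rw [interval_average_eq, sub_zero] at h1
  have hfst := (ContinuousLinearMap.fst ℝ E E).intervalIntegral_comp_comm
    (hf.intervalIntegrable (μ := volume) 0 a)
  have hsnd := (ContinuousLinearMap.snd ℝ E E).intervalIntegral_comp_comm
    (hf.intervalIntegrable (μ := volume) 0 a)
  have hftc : ∫ r in 0..a, V r.toNNReal z = V a.toNNReal x - x := by
    rw [intervalIntegral.integral_eq_sub_of_hasDeriv_right (f := fun r : ℝ => V r.toNNReal x)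
      (hV.continuous_real x).continuousOn _ (hint z)]
    · simp [hV.zero]
    · intro r hr
      rw [min_eq_left ha.le] at hr
      exact ((hd _ hxz).hasDerivWithinAt hV hr.1.le).mono Ioi_subset_Ici_self
  simp only [ContinuousLinearMap.coe_fst', ContinuousLinearMap.coe_snd'] at hfst hsnd
  rw [hftc] at hsnd
  change (a⁻¹ • (∫ r in 0..a, V r.toNNReal x), a⁻¹ • (V a.toNNReal x - x)) ∈ Γ
  rw [hfst, hsnd]
  exact h1

/-- A densely defined restriction of the generator of a contraction semigroup with invariant closed
graph is a core. -/
theorem isGenerator_closure {V : ℝ≥0 → E →L[𝕜] E} (hV : IsC0Semigroup V)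
    (hV1 : ∀ a, ‖V a‖ ≤ 1) (B : E →ₗ.[𝕜] E) (hdense : Dense (B.domain : Set E))
    (hB : ∀ p ∈ B.graph, HasDerivAtZero V p.1 p.2)
    (hinv : ∀ a, ∀ p ∈ B.graph.topologicalClosure, (V a p.1, V a p.2) ∈ B.graph.topologicalClosure) :
    B.IsClosable ∧ IsGenerator B.closure V := by
  have hd : ∀ p ∈ B.graph.topologicalClosure, HasDerivAtZero V p.1 p.2 := fun p hp =>
    hasDerivAtZero_of_mem_closure hV hV1 hB hp
  have hcl : B.IsClosable := by
    -- A pair `(0, z)` in the closure has `z` as derivative of the zero orbit, so `z = 0` and the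
    -- closure is a graph.
    refine ⟨B.graph.topologicalClosure.toLinearPMap, (Submodule.toLinearPMap_graph_eq _ ?_).symm⟩
    rintro ⟨x, z⟩ hp rfl
    refine tendsto_nhds_unique (hd _ hp) (tendsto_const_nhds.congr fun h => ?_)
    simp
  refine ⟨hcl, hV, fun x z => ?_⟩
  rw [← hcl.graph_closure_eq_closure_graph]
  refine ⟨fun h => hd _ h, fun h => ?_⟩
  have hclosed := B.graph.isClosed_topologicalClosure
  have hdense' : Dense (Prod.fst '' (B.graph.topologicalClosure : Set (E × E))) := by
    refine hdense.mono fun y hy => ?_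
    exact ⟨(y, B ⟨y, hy⟩), B.graph.le_topologicalClosure (B.mem_graph ⟨y, hy⟩), rfl⟩
  have h1 : Tendsto (fun a : ℝ => a⁻¹ • (∫ r in 0..a, V r.toNNReal x)) (𝓝[>] 0) (𝓝 x) := by
    have := ((hV.continuous_real x).integral_hasStrictDerivAt 0 0).hasDerivAt
      |>.tendsto_slope_zero_right
    simpa [hV.zero] using this
  refine hclosed.mem_of_tendsto (h1.prodMk_nhds (hasDerivAtZero_iff_real.1 h)) ?_
  filter_upwards [self_mem_nhdsWithin] with a ha
  -- As `a ↓ 0`, the averages approximate `(x, z)` within the closed graph whenever `z` is the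
  -- derivative of the orbit of `x`.
  exact average_mem_of_invariant hV hV1 _ hclosed hd hinv hdense' ha x

end Core

/-! ### Partitions and the Chernoff product formula -/

theorem TimePartition.le_mesh {s t : ℝ} (P : TimePartition s t) (j : Fin P.n) :
    P.pts j.succ - P.pts j.castSucc ≤ P.mesh :=
  le_ciSup (f := fun j : Fin P.n => P.pts j.succ - P.pts j.castSucc) (finite_range _).bddAbove j

theorem TimePartition.lt_succ {s t : ℝ} (P : TimePartition s t) (j : Fin P.n) :
    P.pts j.castSucc < P.pts j.succ :=
  P.strictMono j.castSucc_lt_succ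

theorem TimePartition.le_pts {s t : ℝ} (P : TimePartition s t) (j : Fin (P.n + 1)) :
    s ≤ P.pts j :=
  P.first.symm.trans_le (P.strictMono.monotone (Fin.zero_le j))

theorem TimePartition.pts_le {s t : ℝ} (P : TimePartition s t) (j : Fin (P.n + 1)) :
    P.pts j ≤ t :=
  (P.strictMono.monotone (Fin.le_last j)).trans_eq P.last

section Chernoff

variable {𝕜 E : Type*} [RCLike 𝕜] [NormedAddCommGroup E] [NormedSpace 𝕜 E]

theorem norm_list_prod_le_one (l : List (E →L[𝕜] E)) (h : ∀ X ∈ l, ‖X‖ ≤ 1) : ‖l.prod‖ ≤ 1 := by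
  induction l with
  | nil => exact ContinuousLinearMap.norm_id_le
  | cons X l ih =>
    rw [List.prod_cons]
    exact norm_mul_le_one (h X (by simp)) (ih fun Z hZ => h Z (by simp [hZ]))

/-- Telescoping for products of contractions along a partition. -/
theorem norm_prod_sub_le {n : ℕ} (X : Fin n → E →L[𝕜] E) (hX : ∀ j, ‖X j‖ ≤ 1)
    (v : Fin (n + 1) → E) (p : Fin (n + 1) → ℝ) (ε : ℝ)
    (h : ∀ j : Fin n, ‖X j (v j.succ) - v j.castSucc‖ ≤ ε * (p j.succ - p j.castSucc)) :
    ‖(List.ofFn X).prod (v (Fin.last n)) - v 0‖ ≤ ε * (p (Fin.last n) - p 0) := by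
  induction n with
  | zero => simp
  | succ n ih =>
    have h1 := ih (fun j => X j.succ) (fun j => hX _) (fun j => v j.succ) (fun j => p j.succ)
      fun j => by simpa using h j.succ
    have h2 := h 0
    simp only [Fin.succ_last, Fin.succ_zero_eq_one, Fin.castSucc_zero] at h1 h2
    rw [List.ofFn_succ, List.prod_cons]
    set Z := (List.ofFn fun j => X j.succ).prod
    have e : (X 0 * Z) (v (Fin.last (n + 1))) - v 0
        = X 0 (Z (v (Fin.last (n + 1))) - v 1) + (X 0 (v 1) - v 0) := by
      rw [map_sub]
      change X 0 (Z _) - _ = _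
      abel
    rw [e]
    have h3 := norm_apply_le (hX 0) (Z (v (Fin.last (n + 1))) - v 1)
    refine (norm_add_le _ _).trans ((add_le_add (h3.trans h1) h2).trans_eq ?_)
    ring

variable [NormedSpace ℝ E] {Y : Type*} [NormedAddCommGroup Y] [NormedSpace 𝕜 Y]

/-- The orbit of a backward propagator is differentiable from the left, uniformly. -/
theorem propagator_increment {S T : ℝ} (i : Y →L[𝕜] E)
    (a : ℝ → Y → E) {C : ℝ}
    (ha : ∀ τ ∈ Icc S T, ∀ y z, ‖a τ y - a τ z‖ ≤ C * ‖y - z‖)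
    (hacont : ∀ y, ContinuousOn (fun τ => a τ y) (Icc S T))
    (U : ℝ → ℝ → E →L[𝕜] E) (hU : IsBackwardPropagator S T U)
    (hleft : ∀ τ ∈ Ioc S T, ∀ y, Tendsto (fun h : ℝ => h⁻¹ • (U (τ - h) τ (i y) - i y)) (𝓝[>] 0)
      (𝓝 (a τ y))) {y : Y} {t : ℝ} (ht : t ∈ Icc S T) {u : ℝ → Y}
    (hu : ContinuousOn u (Icc S t)) (huU : ∀ τ ∈ Icc S t, i (u τ) = U τ t (i y))
    {ε : ℝ} (hε : 0 < ε) :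
    ∃ δ > 0, ∀ p q : ℝ, S ≤ p → p < q → q ≤ t → q - p < δ →
      ‖i (u p) - i (u q) - (q - p) • a q (u q)‖ ≤ ε * (q - p) := by
  -- Equi-Lipschitz continuity of `a τ` and strong continuity in `τ` combine to continuity along the
  -- orbit, hence to uniform continuity on the compact interval.
  have hφ : ContinuousOn (fun τ => a τ (u τ)) (Icc S t) := by
    intro τ hτ
    have h1 : Tendsto (fun σ => a σ (u τ)) (𝓝[Icc S t] τ) (𝓝 (a τ (u τ))) :=
      ((hacont (u τ)).mono (Icc_subset_Icc_right ht.2)) τ hτ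
    have h2 : Tendsto (fun σ => a σ (u σ) - a σ (u τ)) (𝓝[Icc S t] τ) (𝓝 0) := by
      have h3 : Tendsto (fun σ => C * ‖u σ - u τ‖) (𝓝[Icc S t] τ) (𝓝 0) := by
        simpa using (((hu τ hτ).tendsto.sub_const (u τ)).norm).const_mul C
      refine squeeze_zero_norm' ?_ h3
      filter_upwards [self_mem_nhdsWithin] with σ hσ
      exact ha σ ⟨hσ.1, hσ.2.trans ht.2⟩ _ _
    have h4 := h2.add h1
    simp only [sub_add_cancel, zero_add] at h4
    exact h4
  obtain ⟨δ, hδ, H⟩ := Metric.uniformContinuousOn_iff.1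
    (isCompact_Icc.uniformContinuousOn_of_continuous hφ) ε hε
  refine ⟨δ, hδ, fun p q hp hpq hq hd => ?_⟩
  set z := a q (u q)
  have hmem : ∀ r ∈ Icc (-q) (-p), -r ∈ Icc S t := fun r hr =>
    ⟨by linarith [hr.2], by linarith [hr.1]⟩
  -- Reversing time, `r = -τ`, turns the left derivative of the orbit into the right derivative
  -- required by the mean value inequality.
  have h1 := norm_image_sub_le_of_norm_deriv_right_le_segment (a := -q) (b := -p)
    (f := fun r : ℝ => i (u (-r)) - r • z) (f' := fun r => a (-r) (u (-r)) - z)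
    (C := ε) ?_ ?_ ?_ (-p) ⟨by linarith, le_rfl⟩
  · simp only [neg_neg, sub_neg_eq_add] at h1
    rw [neg_add_eq_sub] at h1
    refine le_trans (le_of_eq ?_) h1
    congr 1
    rw [neg_smul, neg_smul, sub_smul]
    abel
  · refine ContinuousOn.sub ?_ (continuous_id.smul continuous_const).continuousOn
    exact i.continuous.comp_continuousOn (hu.comp continuous_neg.continuousOn hmem)
  · intro r hr
    have h2 : HasDerivWithinAt (fun r : ℝ => r • z) ((1 : ℝ) • z) (Ici r) r :=
      (hasDerivWithinAt_id r _).smul_const z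
    rw [one_smul] at h2
    refine HasDerivWithinAt.sub (hasDerivWithinAt_Ici_of_tendsto ?_) h2
    have hr' := hmem r ⟨hr.1, hr.2.le⟩
    have hS : S < -r := by linarith [hr.2]
    refine (hleft (-r) ⟨hS, hr'.2.trans ht.2⟩ (u (-r))).congr' ?_
    filter_upwards [Ioo_mem_nhdsGT (sub_pos.2 hS)] with h hh
    have hm : -(r + h) ∈ Icc S t := ⟨by linarith [hh.2], by linarith [hh.1, hr'.2]⟩
    have e : U (-r - h) t = U (-r - h) (-r) * U (-r) t :=
      hU.comp _ _ _ (by linarith [hh.2]) (by linarith [hh.1]) hr'.2 ht.2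
    rw [huU _ hm, huU _ hr', neg_add', e]
    rfl
  · intro r hr
    have h2 := H (-r) (hmem r ⟨hr.1, hr.2.le⟩) q ⟨by linarith, hq⟩ ?_
    · rw [dist_eq_norm] at h2
      exact h2.le
    · rw [dist_comm, Real.dist_eq, abs_of_nonneg] <;> linarith [hr.1, hr.2]

variable [IsScalarTower ℝ 𝕜 E]

/-- Banach-Steinhaus on `Y`: for fixed `y`, quotients with `h < δ` are close to the bounded function
`a t y`, and those with `h ≥ δ` are at most `2‖i y‖/δ` by contractivity. -/
theorem exists_quotient_bound [CompleteSpace Y] {S T : ℝ} (i : Y →L[𝕜] E) (a : ℝ → Y → E)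
    (hacont : ∀ y, ContinuousOn (fun τ => a τ y) (Icc S T)) (Q : ℝ → ℝ → E →L[𝕜] E)
    (hQ : ∀ p q : ℝ, S ≤ p → p < q → q ≤ T → ‖Q p q‖ ≤ 1)
    (hlim : ∀ y : Y, ∀ ε > 0, ∃ δ > 0, ∀ t ∈ Icc S T, ∀ h : ℝ, 0 < h → h < δ → S ≤ t - h →
      ‖h⁻¹ • (Q (t - h) t (i y) - i y) - a t y‖ < ε) :
    ∃ K : ℝ, 0 ≤ K ∧ ∀ t ∈ Icc S T, ∀ h : ℝ, 0 < h → S ≤ t - h → ∀ y : Y,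
      ‖h⁻¹ • (Q (t - h) t (i y) - i y)‖ ≤ K * ‖y‖ := by
  let ι := {p : ℝ × ℝ // p.1 ∈ Icc S T ∧ 0 < p.2 ∧ S ≤ p.1 - p.2}
  let g : ι → Y →L[𝕜] E := fun p =>
    ((p.1.2⁻¹ : ℝ) : 𝕜) • ((Q (p.1.1 - p.1.2) p.1.1).comp i - i)
  have hg : ∀ p y, g p y = p.1.2⁻¹ • (Q (p.1.1 - p.1.2) p.1.1 (i y) - i y) := fun p y => by
    rw [RCLike.real_smul_eq_coe_smul (K := 𝕜)]; rfl
  obtain ⟨K, hK⟩ := banach_steinhaus (g := g) fun y => by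
    obtain ⟨δ, hδ, h1⟩ := hlim y 1 one_pos
    obtain ⟨c, hc⟩ := isCompact_Icc.exists_bound_of_continuousOn (hacont y)
    refine ⟨max (1 + c) (δ⁻¹ * (‖i y‖ + ‖i y‖)), ?_⟩
    rintro ⟨⟨t, h⟩, ht, h0, hS⟩
    rw [hg]
    dsimp only
    rcases lt_or_ge h δ with hh | hh
    · refine le_max_of_le_left ?_
      have h2 := h1 t ht h h0 hh hS
      have h3 := norm_add_le (h⁻¹ • (Q (t - h) t (i y) - i y) - a t y) (a t y)
      rw [sub_add_cancel] at h3
      have := hc t ht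
      linarith
    · refine le_max_of_le_right ?_
      rw [norm_smul, norm_inv, Real.norm_of_nonneg h0.le]
      have h2 := norm_apply_le (hQ (t - h) t hS (by linarith) ht.2) (i y)
      have h3 := norm_sub_le (Q (t - h) t (i y)) (i y)
      gcongr
      linarith
  refine ⟨max K 0, le_max_right _ _, fun t ht h h0 hS y => ?_⟩
  have := (g ⟨(t, h), ht, h0, hS⟩).le_of_opNorm_le ((hK _).trans (le_max_left K 0)) y
  rwa [hg] at this

/-- The quotients and their limits are Lipschitz in `y` with the constants `K` and `C`, so
convergence at a point extends to a small ball, and finitely many balls cover `k`. -/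
theorem quotient_tendsto_uniformly_on_compact [CompleteSpace Y] {S T : ℝ} (i : Y →L[𝕜] E)
    (a : ℝ → Y → E) {C : ℝ} (hC : 0 ≤ C)
    (ha : ∀ τ ∈ Icc S T, ∀ y z, ‖a τ y - a τ z‖ ≤ C * ‖y - z‖)
    (hacont : ∀ y, ContinuousOn (fun τ => a τ y) (Icc S T)) (Q : ℝ → ℝ → E →L[𝕜] E)
    (hQ : ∀ p q : ℝ, S ≤ p → p < q → q ≤ T → ‖Q p q‖ ≤ 1)
    (hlim : ∀ y : Y, ∀ ε > 0, ∃ δ > 0, ∀ t ∈ Icc S T, ∀ h : ℝ, 0 < h → h < δ → S ≤ t - h →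
      ‖h⁻¹ • (Q (t - h) t (i y) - i y) - a t y‖ < ε) {k : Set Y} (hk : IsCompact k)
    {ε : ℝ} (hε : 0 < ε) :
    ∃ δ > 0, ∀ y ∈ k, ∀ t ∈ Icc S T, ∀ h : ℝ, 0 < h → h < δ → S ≤ t - h →
      ‖h⁻¹ • (Q (t - h) t (i y) - i y) - a t y‖ < ε := by
  obtain ⟨K, hK0, hK⟩ := exists_quotient_bound i a hacont Q hQ hlim
  refine hk.induction_on (p := fun k => ∃ δ > 0, ∀ y ∈ k, ∀ t ∈ Icc S T, ∀ h : ℝ, 0 < h → h < δ →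
    S ≤ t - h → ‖h⁻¹ • (Q (t - h) t (i y) - i y) - a t y‖ < ε) ⟨1, one_pos, by simp⟩ ?_ ?_ ?_
  · rintro k k' hkk ⟨δ, hδ, H⟩
    exact ⟨δ, hδ, fun y hy => H y (hkk hy)⟩
  · rintro k k' ⟨δ, hδ, H⟩ ⟨δ', hδ', H'⟩
    refine ⟨min δ δ', lt_min hδ hδ', fun y hy t ht h h0 hh hS => ?_⟩
    rcases hy with hy | hy
    · exact H y hy t ht h h0 (hh.trans_le (min_le_left _ _)) hS
    · exact H' y hy t ht h h0 (hh.trans_le (min_le_right _ _)) hS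
  · intro y _
    obtain ⟨δ, hδ, H⟩ := hlim y (ε / 2) (by positivity)
    have hpos : 0 < ε / (2 * (K + C + 1)) := by positivity
    refine ⟨Metric.ball y (ε / (2 * (K + C + 1))),
      mem_nhdsWithin_of_mem_nhds (Metric.ball_mem_nhds _ hpos), δ, hδ,
      fun z hz t ht h h0 hh hS => ?_⟩
    rw [Metric.mem_ball, dist_eq_norm, lt_div_iff₀ (by positivity)] at hz
    have h1 := H t ht h h0 hh hS
    have h2 := hK t ht h h0 hS (z - y)
    have h3 := ha t ht y z
    rw [norm_sub_rev y z] at h3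
    have e : h⁻¹ • (Q (t - h) t (i z) - i z) - a t z
        = (h⁻¹ • (Q (t - h) t (i y) - i y) - a t y)
          + h⁻¹ • (Q (t - h) t (i (z - y)) - i (z - y)) + (a t y - a t z) := by
      simp only [map_sub, smul_sub]; abel
    rw [e]
    refine norm_add₃_le.trans_lt ?_
    nlinarith [norm_nonneg (z - y)]

/-- Products of contractions which are consistent with a backward propagator converge strongly
to it. -/
theorem tendsto_chernoffProduct [CompleteSpace Y] {S T : ℝ} (i : Y →L[𝕜] E) (hi : DenseRange i)
    (a : ℝ → Y → E) {C : ℝ} (hC : 0 ≤ C)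
    (ha : ∀ τ ∈ Icc S T, ∀ y z, ‖a τ y - a τ z‖ ≤ C * ‖y - z‖)
    (hacont : ∀ y, ContinuousOn (fun τ => a τ y) (Icc S T))
    (U : ℝ → ℝ → E →L[𝕜] E) (hU : IsBackwardPropagator S T U)
    (hleft : ∀ τ ∈ Ioc S T, ∀ y, Tendsto (fun h : ℝ => h⁻¹ • (U (τ - h) τ (i y) - i y)) (𝓝[>] 0)
      (𝓝 (a τ y)))
    (hcontU : ∀ y : Y, ∀ t ∈ Icc S T, ∃ u : ℝ → Y, ContinuousOn u (Icc S t) ∧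
      ∀ τ ∈ Icc S t, i (u τ) = U τ t (i y))
    (Q : ℝ → ℝ → E →L[𝕜] E) (hQ : ∀ p q : ℝ, S ≤ p → p < q → q ≤ T → ‖Q p q‖ ≤ 1)
    (hlim : ∀ y : Y, ∀ ε > 0, ∃ δ > 0, ∀ t ∈ Icc S T, ∀ h : ℝ, 0 < h → h < δ → S ≤ t - h →
      ‖h⁻¹ • (Q (t - h) t (i y) - i y) - a t y‖ < ε)
    {s t : ℝ} (hs : S ≤ s) (hst : s ≤ t) (ht : t ≤ T) (P : ℕ → TimePartition s t)
    (hP : Tendsto (fun k => (P k).mesh) atTop (𝓝 0)) (x : E) :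
    Tendsto (fun k => (P k).chernoffProduct Q x) atTop (𝓝 (U s t x)) := by
  have htm : t ∈ Icc S T := ⟨hs.trans hst, ht⟩
  have hQP : ∀ k (j : Fin (P k).n), ‖Q ((P k).pts j.castSucc) ((P k).pts j.succ)‖ ≤ 1 := fun k j =>
    hQ _ _ (hs.trans ((P k).le_pts _)) ((P k).lt_succ j) (((P k).pts_le _).trans ht)
  refine tendsto_of_dense (fun k => ?_) hi (fun x hx => ?_) x
  · refine norm_list_prod_le_one _ fun X hX => ?_
    obtain ⟨j, rfl⟩ := (List.mem_ofFn' _ _).1 hX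
    exact hQP k j
  obtain ⟨y, rfl⟩ := hx
  obtain ⟨u, hu, huU⟩ := hcontU y t htm
  rw [Metric.tendsto_atTop]
  intro ε hε
  -- Consistency of `Q` and differentiability of `U` each cost one share per unit of time; the `+ 1`
  -- covers `s = t` and makes the total strictly less than `ε`.
  have hη : 0 < ε / (2 * (t - s + 1)) := div_pos hε (by linarith)
  obtain ⟨δ, hδ, H⟩ := propagator_increment i a ha hacont U hU hleft htm hu huU hη
  obtain ⟨δ', hδ', H'⟩ := quotient_tendsto_uniformly_on_compact i a hC ha hacont Q hQ hlim
    (isCompact_Icc.image_of_continuousOn hu) hη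
  obtain ⟨N, hN⟩ := Metric.tendsto_atTop.1 hP (min δ δ') (lt_min hδ hδ')
  refine ⟨N, fun k hk => ?_⟩
  have hmesh : (P k).mesh < min δ δ' := by
    have := hN k hk
    rw [Real.dist_eq, sub_zero] at this
    exact (le_abs_self _).trans_lt this
  have h1 := norm_prod_sub_le (fun j : Fin (P k).n => Q ((P k).pts j.castSucc) ((P k).pts j.succ))
    (hQP k) (fun j => i (u ((P k).pts j))) (P k).pts (ε / (t - s + 1)) fun j => ?_
  · rw [(P k).first, (P k).last, huU t ⟨htm.1, le_rfl⟩, huU s ⟨hs, hst⟩, hU.refl t htm] at h1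
    rw [dist_eq_norm]
    refine h1.trans_lt ?_
    rw [div_mul_eq_mul_div, div_lt_iff₀ (by linarith)]
    nlinarith
  · set p := (P k).pts j.castSucc
    set q := (P k).pts j.succ
    have hpq : p < q := (P k).lt_succ j
    have hp : S ≤ p := hs.trans ((P k).le_pts _)
    have hq : q ≤ t := (P k).pts_le _
    have hd : q - p < min δ δ' := ((P k).le_mesh j).trans_lt hmesh
    have h2 := H p q hp hpq hq (hd.trans_le (min_le_left _ _))
    have h3 := H' (u q) ⟨q, ⟨by linarith, hq⟩, rfl⟩ q ⟨by linarith, hq.trans ht⟩ (q - p)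
      (by linarith) (hd.trans_le (min_le_right _ _)) (by linarith)
    rw [sub_sub_cancel] at h3
    have hqp : 0 < q - p := sub_pos.2 hpq
    have e : Q p q (i (u q)) - i (u p)
        = (q - p) • ((q - p)⁻¹ • (Q p q (i (u q)) - i (u q)) - a q (u q))
          - (i (u p) - i (u q) - (q - p) • a q (u q)) := by
      rw [smul_sub (q - p) ((q - p)⁻¹ • _), smul_smul, mul_inv_cancel₀ hqp.ne', one_smul]
      abel
    rw [e]
    refine (norm_sub_le _ _).trans ?_
    rw [norm_smul, Real.norm_of_nonneg hqp.le]
    have e2 : ε / (t - s + 1) = 2 * (ε / (2 * (t - s + 1))) := by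
      have : t - s + 1 ≠ 0 := by linarith
      field_simp
    rw [e2]
    nlinarith

end Chernoff

/-! ### Uniform partitions and Riemann sums -/

section UniformPartition

/-- The partition of `[s, t]` into `n + 1` intervals of equal length. -/
noncomputable def uniformPartition {s t : ℝ} (hst : s < t) (n : ℕ) : TimePartition s t where
  n := n + 1
  pts j := s + j * ((t - s) / (n + 1))
  strictMono j k hjk := by
    have h1 : 0 < (t - s) / (n + 1) := div_pos (sub_pos.2 hst) (by positivity)
    have h2 : ((j : ℕ) : ℝ) < (k : ℕ) := by exact_mod_cast hjk
    simpa using mul_lt_mul_of_pos_right h2 h1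
  first := by simp
  last := by
    have : (n : ℝ) + 1 ≠ 0 := by positivity
    simp only [Fin.val_last]
    push_cast
    field_simp
    ring

theorem uniformPartition_sub {s t : ℝ} (hst : s < t) (n : ℕ) (j : Fin (n + 1)) :
    (uniformPartition hst n).pts j.succ - (uniformPartition hst n).pts j.castSucc
      = (t - s) / (n + 1) := by
  simp only [uniformPartition, Fin.val_succ, Fin.val_castSucc]
  push_cast
  ring

theorem tendsto_mesh_uniformPartition {s t : ℝ} (hst : s < t) :
    Tendsto (fun n => (uniformPartition hst n).mesh) atTop (𝓝 0) := by
  have h1 := (tendsto_one_div_add_atTop_nhds_zero_nat (𝕜 := ℝ)).const_mul (t - s)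
  rw [mul_zero] at h1
  refine h1.congr fun n => ?_
  have e : (uniformPartition hst n).mesh = ⨆ _ : Fin (n + 1), (t - s) / ((n : ℝ) + 1) :=
    iSup_congr fun j => uniformPartition_sub hst n j
  rw [e, ciSup_const, mul_one_div]

theorem chernoffProduct_uniformPartition {𝕜 E : Type*} [RCLike 𝕜] [NormedAddCommGroup E]
    [NormedSpace 𝕜 E] {s t : ℝ} (hst : s < t) (n : ℕ) (F : ℝ → E →L[𝕜] E) :
    (uniformPartition hst n).chernoffProduct (fun p q => F (q - p))
      = F ((t - s) / (n + 1)) ^ (n + 1) := by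
  rw [← List.prod_replicate, ← List.ofFn_const]
  exact congrArg (fun f => (List.ofFn f).prod)
    (funext fun j => congrArg F (uniformPartition_sub hst n j))

theorem sum_sub_castSucc {G : Type*} [AddCommGroup G] {n : ℕ} (f : Fin (n + 1) → G) :
    ∑ j : Fin n, (f j.succ - f j.castSucc) = f (Fin.last n) - f 0 := by
  induction n with
  | zero => simp
  | succ n ih =>
    have := ih fun j => f j.castSucc
    rw [Fin.sum_univ_castSucc]
    simp only [← Fin.succ_castSucc] at this ⊢
    simp only [Fin.succ_last, Fin.castSucc_zero] at this ⊢
    rw [this]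
    abel

/-- The tags are right endpoints: these are greater than `s ≥ S`, and only at times after `S` are
the semigroups shown to be contractive. -/
theorem tendsto_riemannSum {E : Type*} [NormedAddCommGroup E] [NormedSpace ℝ E]
    [CompleteSpace E] {s t : ℝ} (hst : s ≤ t) {f : ℝ → E} (hf : ContinuousOn f (Icc s t))
    (P : ℕ → TimePartition s t) (hP : Tendsto (fun k => (P k).mesh) atTop (𝓝 0)) :
    Tendsto (fun k => ∑ j : Fin (P k).n,
      ((P k).pts j.succ - (P k).pts j.castSucc) • f ((P k).pts j.succ)) atTop
      (𝓝 (∫ r in s..t, f r)) := by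
  rw [Metric.tendsto_atTop]
  intro ε hε
  have hη : 0 < ε / (t - s + 1) := div_pos hε (by linarith)
  obtain ⟨δ, hδ, H⟩ := Metric.uniformContinuousOn_iff.1
    (isCompact_Icc.uniformContinuousOn_of_continuous hf) _ hη
  obtain ⟨N, hN⟩ := Metric.tendsto_atTop.1 hP δ hδ
  refine ⟨N, fun k hk => ?_⟩
  have hmesh : (P k).mesh < δ := by
    have := hN k hk
    rw [Real.dist_eq, sub_zero] at this
    exact (le_abs_self _).trans_lt this
  have hint : ∀ p ∈ Icc s t, ∀ q ∈ Icc s t, IntervalIntegrable f volume p q := fun p hp q hq =>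
    (hf.mono (uIcc_subset_Icc hp hq)).intervalIntegrable
  have hmem : ∀ j, (P k).pts j ∈ Icc s t := fun j => ⟨(P k).le_pts j, (P k).pts_le j⟩
  have h1 := sum_sub_castSucc fun j => ∫ r in s..(P k).pts j, f r
  rw [(P k).first, (P k).last, intervalIntegral.integral_same, sub_zero] at h1
  rw [dist_eq_norm, ← h1, ← Finset.sum_sub_distrib]
  have h2 : ∀ j : Fin (P k).n,
      ‖((P k).pts j.succ - (P k).pts j.castSucc) • f ((P k).pts j.succ)
        - ((∫ r in s..(P k).pts j.succ, f r) - ∫ r in s..(P k).pts j.castSucc, f r)‖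
      ≤ ε / (t - s + 1) * ((P k).pts j.succ - (P k).pts j.castSucc) := fun j => by
    have hs : s ∈ Icc s t := ⟨le_rfl, hst⟩
    have hlt := (P k).lt_succ j
    rw [intervalIntegral.integral_interval_sub_left (hint _ hs _ (hmem _)) (hint _ hs _ (hmem _)),
      ← intervalIntegral.integral_const, ← intervalIntegral.integral_sub
        intervalIntegrable_const (hint _ (hmem _) _ (hmem _))]
    refine (intervalIntegral.norm_integral_le_of_norm_le_const fun r hr => ?_).trans_eq
      (by rw [abs_of_pos (sub_pos.2 hlt)])
    rw [uIoc_of_le hlt.le] at hr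
    have h3 := H _ (hmem j.succ) r
      ⟨(hmem j.castSucc).1.trans hr.1.le, hr.2.trans (hmem j.succ).2⟩ ?_
    · rw [dist_eq_norm] at h3
      exact h3.le
    · rw [Real.dist_eq, abs_of_nonneg (by linarith [hr.2])]
      linarith [(P k).le_mesh j, hr.1]
  refine (norm_sum_le_of_le _ fun j _ => h2 j).trans_lt ?_
  rw [← Finset.mul_sum, sum_sub_castSucc, (P k).first, (P k).last, div_mul_eq_mul_div,
    div_lt_iff₀ (by linarith)]
  nlinarith

end UniformPartition

/-! ### Generators as limits of the propagator; uniform difference quotients -/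

section Generators

variable {𝕜 E : Type*} [RCLike 𝕜] [NormedAddCommGroup E] [NormedSpace 𝕜 E]

theorem norm_pow_le_one {X : E →L[𝕜] E} (hX : ‖X‖ ≤ 1) (n : ℕ) : ‖X ^ n‖ ≤ 1 := by
  rw [← List.prod_replicate]
  exact norm_list_prod_le_one _ fun Z hZ => by rwa [List.eq_of_mem_replicate hZ]

/-- The powers of `U(t - c/n, t)` are controlled only for `c ≤ t - S`; larger times are reached by
the semigroup law. -/
theorem exists_nsmul_small {c : ℝ≥0} (hc : 0 < c) {ε : ℝ} (hε : 0 < ε) :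
    ∃ (n : ℕ) (d : ℝ≥0), 0 < (d : ℝ) ∧ (d : ℝ) ≤ ε ∧ c = n • d := by
  obtain ⟨n, hn⟩ := exists_nat_gt ((c : ℝ) / ε)
  have hn0 : 0 < n := by
    have : (0 : ℝ) < n := lt_of_le_of_lt (by positivity) hn
    exact_mod_cast this
  have hn' : (0 : ℝ) < n := by exact_mod_cast hn0
  refine ⟨n, c / n, NNReal.coe_pos.2 (div_pos hc (by exact_mod_cast hn0)), ?_, ?_⟩
  · push_cast
    rw [div_lt_iff₀ hε] at hn
    rw [div_le_iff₀ hn']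
    linarith
  · rw [nsmul_eq_mul, mul_div_cancel₀]
    exact_mod_cast hn0.ne'

/-- The bounded operators which map a subspace of `E × E` (a graph) into itself. -/
def graphStabilizer (Γ : Submodule 𝕜 (E × E)) : Submonoid (E →L[𝕜] E) where
  carrier := {X | ∀ p ∈ Γ, (X p.1, X p.2) ∈ Γ}
  one_mem' := fun _ hp => hp
  mul_mem' := fun hX hZ p hp => hX _ (hZ p hp)

theorem mem_graphStabilizer_of_tendsto {Γ : Submodule 𝕜 (E × E)} (hΓ : IsClosed (Γ : Set (E × E)))
    {X : ℕ → E →L[𝕜] E} {Z : E →L[𝕜] E} (h : ∀ x, Tendsto (fun n => X n x) atTop (𝓝 (Z x)))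
    (hX : ∀ n, X n ∈ graphStabilizer Γ) : Z ∈ graphStabilizer Γ := fun p hp =>
  hΓ.mem_of_tendsto ((h p.1).prodMk_nhds (h p.2)) (Eventually.of_forall fun n => hX n p hp)

theorem mem_graphStabilizer_topologicalClosure {Γ : Submodule 𝕜 (E × E)} {X : E →L[𝕜] E}
    (hX : X ∈ graphStabilizer Γ) : X ∈ graphStabilizer Γ.topologicalClosure := fun p hp =>
  map_mem_closure (f := fun p : E × E => (X p.1, X p.2)) (by fun_prop) hp hX

theorem ap_mem_graph (A : E →ₗ.[𝕜] E) {x : E} (h : x ∈ A.domain) : (x, ap A x) ∈ A.graph := by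
  rw [ap_of_mem A h]
  exact A.mem_graph ⟨x, h⟩

theorem ap_sub (A : E →ₗ.[𝕜] E) {x y : E} (hx : x ∈ A.domain) (hy : y ∈ A.domain) :
    ap A (x - y) = ap A x - ap A y := by
  rw [ap_of_mem A hx, ap_of_mem A hy, ap_of_mem A (A.domain.sub_mem hx hy)]
  exact A.map_sub ⟨x, hx⟩ ⟨y, hy⟩

variable [NormedSpace ℝ E]

/-- The graph is the set where the continuous maps `(x, z) ↦ R(l x - z)` and `(x, z) ↦ x` agree.
Being closed, it is a Banach space and can replace `Y` in the product formula. -/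
theorem IsResolvent.isClosed_graph {A : E →ₗ.[𝕜] E} {l : ℝ} {R : E →L[𝕜] E}
    (h : IsResolvent A l R) : IsClosed (A.graph : Set (E × E)) := by
  have e : (A.graph : Set (E × E)) = {p | R (l • p.1 - p.2) = p.1} := by
    ext ⟨x, z⟩
    rw [SetLike.mem_coe, LinearPMap.mem_graph_iff]
    constructor
    · rintro ⟨y, rfl, rfl⟩
      exact h.left_inv y
    · intro hx
      obtain ⟨hd, hR⟩ := h.right_inv (l • x - z)
      replace hx : R (l • x - z) = x := hx
      refine ⟨⟨_, hd⟩, hx, ?_⟩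
      have h1 : l • R (l • x - z) - A ⟨_, hd⟩ = l • R (l • x - z) - z := by rw [hR, hx]
      exact sub_right_injective h1
  rw [e]
  exact isClosed_eq (by fun_prop) (by fun_prop)

variable [IsScalarTower ℝ 𝕜 E]

/-- The Chernoff product formula for the semigroup generated by a left generator of a contractive
propagator. -/
theorem tendsto_pow_semigroup [CompleteSpace E] {A : E →ₗ.[𝕜] E} {V : ℝ≥0 → E →L[𝕜] E}
    (hV : IsGenerator A V) (hclosed : IsClosed (A.graph : Set (E × E)))
    (hdense : Dense (A.domain : Set E)) {U : ℝ → ℝ → E →L[𝕜] E} {S t : ℝ}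
    (hleft : IsLeftGenerator U t A) (hU1 : ∀ s, S ≤ s → s ≤ t → ‖U s t‖ ≤ 1) {c : ℝ} (hc : 0 < c)
    (hct : S ≤ t - c) (x : E) :
    Tendsto (fun n : ℕ => (U (t - c / (n + 1)) t ^ (n + 1)) x) atTop (𝓝 (V c.toNNReal x)) := by
  have hgraph : ∀ p : E × E, p ∈ A.graph → HasDerivAtZero V p.1 p.2 := fun p hp =>
    (hV.graph p.1 p.2).1 hp
  have hinv : ∀ b, ∀ p ∈ A.graph, (V b p.1, V b p.2) ∈ A.graph := fun b p hp =>
    (hV.graph _ _).2 ((hgraph p hp).map fun d => hV.semigroup.commute d b)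
  have : CompleteSpace A.graph := hclosed.completeSpace_coe
  let i : A.graph →L[𝕜] E := (ContinuousLinearMap.fst 𝕜 E E).comp A.graph.subtypeL
  have hlt : t - c < t := by linarith
  -- The role of `Y` is played by the graph, with the first projection as injection and the second
  -- as `a`, so `C = 1`. The propagator is `V(q - p)`, and the contractions depend on `q - p` alone,
  -- so products over uniform partitions are powers.
  have key := tendsto_chernoffProduct (S := t - c) (T := t) i
    (hdense.mono fun y hy => ⟨⟨(y, ap A y), ap_mem_graph A hy⟩, rfl⟩)
    (fun _ y => y.1.2) (C := 1) zero_le_one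
    (fun τ _ y z => by
      rw [one_mul]
      exact norm_snd_le (y.1 - z.1))
    (fun y => continuousOn_const)
    (fun p q => V (q - p).toNNReal)
    ⟨fun p τ q _ h1 h2 _ => by
      rw [← hV.semigroup.add, ← Real.toNNReal_add (by linarith) (by linarith)]
      congr 2
      ring, fun p _ => by simp [hV.semigroup.zero]⟩
    (fun τ _ y => by
      simp only [sub_sub_cancel]
      exact hasDerivAtZero_iff_real.1 (hgraph y.1 y.2))
    (fun y q _ => by
      refine ⟨fun τ => ⟨(V (q - τ).toNNReal y.1.1, V (q - τ).toNNReal y.1.2),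
        hinv _ _ y.2⟩, Continuous.continuousOn ?_, fun τ _ => rfl⟩
      exact (((hV.semigroup.continuous_real _).comp (continuous_const.sub continuous_id)).prodMk
        ((hV.semigroup.continuous_real _).comp (continuous_const.sub continuous_id))).subtype_mk _)
    (fun p q => U (t - (q - p)) t)
    (fun p q h1 h2 h3 => hU1 _ (by linarith) (by linarith))
    (fun y ε hε => by
      obtain ⟨δ, hδ, H⟩ := tendsto_nhdsGT_zero_iff.1 ((hleft _ _).1 y.2) ε hε
      refine ⟨δ, hδ, fun q _ h h0 hh _ => ?_⟩
      rw [sub_sub_cancel]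
      exact H h h0 hh)
    le_rfl hlt.le le_rfl (uniformPartition hlt) (tendsto_mesh_uniformPartition hlt) x
  simp only [chernoffProduct_uniformPartition hlt _ fun h => U (t - h) t, sub_sub_cancel] at key
  exact key

/-- The difference quotients of contraction semigroups at a fixed vector converge uniformly, if
the derivatives depend continuously on the parameter. -/
theorem semigroup_quotient_uniform {Y : Type*} [NormedAddCommGroup Y] [NormedSpace 𝕜 Y] {S T : ℝ}
    (i : Y →L[𝕜] E) (hi : DenseRange i) (a : ℝ → Y → E) {C : ℝ} (hC : 0 ≤ C)
    (ha : ∀ τ ∈ Icc S T, ∀ y, ‖a τ y‖ ≤ C * ‖y‖)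
    (hacont : ∀ y, ContinuousOn (fun τ => a τ y) (Icc S T)) (G : ℝ → ℝ≥0 → E →L[𝕜] E)
    (hG : ∀ τ ∈ Ioc S T, IsC0Semigroup (G τ)) (hG1 : ∀ τ ∈ Ioc S T, ∀ c, ‖G τ c‖ ≤ 1)
    (hGd : ∀ τ ∈ Ioc S T, ∀ y, HasDerivAtZero (G τ) (i y) (a τ y)) (y : Y) {ε : ℝ} (hε : 0 < ε) :
    ∃ δ > 0, ∀ t ∈ Icc S T, ∀ h : ℝ, 0 < h → h < δ → S ≤ t - h →
      ‖h⁻¹ • (G t h.toNNReal (i y) - i y) - a t y‖ < ε := by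
  -- The set of all `a τ y` is compact and `Y` is dense, so vectors of `Y` of norm at most a single
  -- `R` approximate it. For such `z`, `‖G τ r (i z) - i z‖ ≤ r C R` independently of `τ`.
  obtain ⟨R, hR⟩ : ∃ R : ℕ, ∀ τ ∈ Icc S T, ∃ z : Y, ‖z‖ ≤ R ∧ ‖a τ y - i z‖ < ε / 8 := by
    have hk := isCompact_Icc.image_of_continuousOn (hacont y)
    obtain ⟨R, hR⟩ := hk.elim_directed_cover
      (fun n : ℕ => ⋃ z ∈ {z : Y | ‖z‖ ≤ n}, Metric.ball (i z) (ε / 8))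
      (fun n => isOpen_biUnion fun z _ => Metric.isOpen_ball)
      (fun x _ => by
        obtain ⟨z, hz⟩ := Metric.denseRange_iff.1 hi x (ε / 8) (by positivity)
        obtain ⟨n, hn⟩ := exists_nat_ge ‖z‖
        exact mem_iUnion.2 ⟨n, mem_biUnion (x := z) hn hz⟩)
      (directed_of_isDirected_le fun m n hmn => biUnion_subset_biUnion_left fun z hz =>
        (show ‖z‖ ≤ m from hz).trans (by exact_mod_cast hmn))
    refine ⟨R, fun τ hτ => ?_⟩
    obtain ⟨z, hz, hzb⟩ := mem_iUnion₂.1 (hR ⟨τ, hτ, rfl⟩)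
    rw [Metric.mem_ball, dist_eq_norm] at hzb
    exact ⟨z, hz, hzb⟩
  have hpos : 0 < 4 * (C * R + 1) := by positivity
  refine ⟨ε / (4 * (C * R + 1)), by positivity, fun t ht h h0 hh hS => ?_⟩
  -- Since `h > 0`, the condition `S ≤ t - h` excludes `t = S`.
  have htm : t ∈ Ioc S T := ⟨by linarith, ht.2⟩
  obtain ⟨z, hzR, hz⟩ := hR t ht
  rw [lt_div_iff₀ hpos] at hh
  have h1 : ∀ r : ℝ, 0 ≤ r → r ≤ h → ‖G t r.toNNReal (a t y) - a t y‖ ≤ ε / 2 := fun r hr hrh => by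
    have e : G t r.toNNReal (a t y) - a t y
        = G t r.toNNReal (a t y - i z) + (G t r.toNNReal (i z) - i z) - (a t y - i z) := by
      rw [map_sub]; abel
    have h2 := norm_apply_le (hG1 t htm r.toNNReal) (a t y - i z)
    have h3 := norm_increment_le (hG t htm) (hG1 t htm) (hGd t htm z) hr
    have h4 : r * ‖a t z‖ ≤ h * (C * R) := by
      have := ha t ht z
      gcongr
      exact this.trans (by gcongr)
    have h5 := norm_add_le (G t r.toNNReal (a t y - i z)) (G t r.toNNReal (i z) - i z)
    rw [e]
    refine (norm_sub_le _ _).trans ?_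
    nlinarith
  have h2 := norm_increment_sub_le (hG t htm) (hG1 t htm) (hGd t htm y) h0.le h1
  rw [sub_self, norm_zero, add_zero] at h2
  have e : h⁻¹ • (G t h.toNNReal (i y) - i y) - a t y
      = h⁻¹ • (G t h.toNNReal (i y) - i y - h • a t y) := by
    rw [smul_sub h⁻¹ _ (h • a t y), smul_smul, inv_mul_cancel₀ h0.ne', one_smul]
  rw [e, norm_smul, norm_inv, Real.norm_of_nonneg h0.le, inv_mul_lt_iff₀ h0]
  nlinarith

end Generators

end ChernoffProducts

/-! ### The main theorem -/

theorem corollary1 {𝕜 E Y : Type*} [RCLike 𝕜]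
    [NormedAddCommGroup E] [NormedSpace 𝕜 E] [NormedSpace ℝ E] [IsScalarTower ℝ 𝕜 E]
    [CompleteSpace E]
    [NormedAddCommGroup Y] [NormedSpace 𝕜 Y] [CompleteSpace Y]
    (S T : ℝ) (hS : 0 ≤ S) (hST : S ≤ T)
    -- a stable family of pairwise commuting generators `A t` of `C₀`-semigroups `G t`
    (A : ℝ → E →ₗ.[𝕜] E) (G : ℝ → ℝ≥0 → E →L[𝕜] E)
    (hgen : ∀ t ∈ Icc S T, IsGenerator (A t) (G t))
    (hcomm : ∀ r ∈ Icc S T, ∀ t ∈ Icc S T, ∀ a b : ℝ≥0, Commute (G r a) (G t b))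
    (hstable : IsStable (Icc S T) A)
    -- a backward propagator with left generators `A t`
    (U : ℝ → ℝ → E →L[𝕜] E) (hU : IsBackwardPropagator S T U)
    (hleft : ∀ t ∈ Ioc S T, IsLeftGenerator U t (A t))
    -- a two-parameter family of contractions
    (Q : ℝ → ℝ → E →L[𝕜] E)
    (hQ : ∀ t₁ t₂ : ℝ, S ≤ t₁ → t₁ ≤ t₂ → t₂ ≤ T → ‖Q t₁ t₂‖ ≤ 1)
    -- the intersection of the domains is dense
    (hdense : Dense (⋂ t ∈ Icc S T, ((A t).domain : Set E)))
    -- the Banach space `Y`, a dense subspace of `E` via the injection `i`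
    (i : Y →ₗ[𝕜] E) (hi : Function.Injective i) (hidense : DenseRange i)
    (hidom : ∀ t ∈ Icc S T, ∀ y : Y, i y ∈ (A t).domain)
    (hinv : ∀ s t : ℝ, S ≤ s → s < t → t ≤ T → ∀ y : Y, U s t (i y) ∈ LinearMap.range i)
    (γ : ℝ) (hγ : 0 < γ)
    (hnorm : ∀ y : Y, ∀ τ ∈ Icc S T, γ * (‖i y‖ + ‖ap (A τ) (i y)‖) ≤ ‖y‖)
    -- `τ ↦ U(τ,t)y` is continuous as a map from `[S,t]` to `Y`
    (hcontU : ∀ y : Y, ∀ t ∈ Icc S T, ∃ u : ℝ → Y, ContinuousOn u (Icc S t) ∧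
      ∀ τ ∈ Icc S t, i (u τ) = U τ t (i y))
    -- `t ↦ A_t y` is continuous as a map from `[S,T]` to `E`
    (hcontA : ∀ y : Y, ContinuousOn (fun t => ap (A t) (i y)) (Icc S T))
    -- `(Q_{t-h,t}y - y)/h → A_t y` as `h ↓ 0`, uniformly in `t`
    (hlim : ∀ y : Y, ∀ ε > 0, ∃ δ > 0, ∀ t ∈ Icc S T, ∀ h : ℝ, 0 < h → h < δ → S ≤ t - h →
      ‖h⁻¹ • (Q (t - h) t (i y) - i y) - ap (A t) (i y)‖ < ε) :
    ∀ s t : ℝ, S ≤ s → s ≤ t → t ≤ T →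
      (integralOp A (LinearMap.range i) s t).domain = LinearMap.range i ∧
      (integralOp A (LinearMap.range i) s t).IsClosable ∧
      ∃ V : ℝ≥0 → E →L[𝕜] E,
        IsGenerator (integralOp A (LinearMap.range i) s t).closure V ∧
        ∀ P : ℕ → TimePartition s t, Tendsto (fun k => (P k).mesh) atTop (𝓝 0) →
          ∀ x : E, Tendsto (fun k => (P k).chernoffProduct Q x) atTop (𝓝 (V 1 x)) := by
  obtain ⟨M, ω, R, -, hR, -⟩ := hstable
  have hclosed : ∀ t ∈ Icc S T, IsClosed ((A t).graph : Set (E × E)) := fun t ht =>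
    (hR (ω + 1) (by simp) t ht).isClosed_graph
  have hdom : ∀ t ∈ Icc S T, Dense ((A t).domain : Set E) := fun t ht =>
    hdense.mono (iInter₂_subset t ht)
  -- the injection as a bounded operator
  have hibound : ∀ y, ‖i y‖ ≤ γ⁻¹ * ‖y‖ := fun y => by
    rw [le_inv_mul_iff₀ hγ]
    refine le_trans ?_ (hnorm y S ⟨le_rfl, hST⟩)
    gcongr
    exact le_add_of_nonneg_right (norm_nonneg _)
  let L : Y →L[𝕜] E := i.mkContinuous γ⁻¹ hibound
  let a : ℝ → Y → E := fun τ y => ap (A τ) (i y)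
  have haγ : ∀ τ ∈ Icc S T, ∀ y, ‖a τ y‖ ≤ γ⁻¹ * ‖y‖ := fun τ hτ y => by
    rw [le_inv_mul_iff₀ hγ]
    refine le_trans ?_ (hnorm y τ hτ)
    gcongr
    exact le_add_of_nonneg_left (norm_nonneg _)
  have halip : ∀ τ ∈ Icc S T, ∀ y z, ‖a τ y - a τ z‖ ≤ γ⁻¹ * ‖y - z‖ := fun τ hτ y z => by
    have := haγ τ hτ (y - z)
    simp only [a, map_sub] at this ⊢
    rwa [ap_sub _ (hidom τ hτ y) (hidom τ hτ z)] at this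
  have hagraph : ∀ τ ∈ Icc S T, ∀ y, (i y, a τ y) ∈ (A τ).graph := fun τ hτ y =>
    ap_mem_graph _ (hidom τ hτ y)
  have hGd : ∀ τ ∈ Icc S T, ∀ y, HasDerivAtZero (G τ) (i y) (a τ y) := fun τ hτ y =>
    ((hgen τ hτ).graph _ _).1 (hagraph τ hτ y)
  have hleft' : ∀ τ ∈ Ioc S T, ∀ y,
      Tendsto (fun h : ℝ => h⁻¹ • (U (τ - h) τ (L y) - L y)) (𝓝[>] 0) (𝓝 (a τ y)) :=
    fun τ hτ y => (hleft τ hτ _ _).1 (hagraph τ ⟨hτ.1.le, hτ.2⟩ y)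
  have chernoff := fun (K : ℝ → ℝ → E →L[𝕜] E) hK hK' {s t : ℝ} (hs : S ≤ s) (hst : s ≤ t)
      (ht : t ≤ T) => tendsto_chernoffProduct (S := S) (T := T) L hidense a (inv_pos.2 hγ).le
        halip hcontA U hU hleft' hcontU K hK hK' hs hst ht
  have hQU := fun {s t : ℝ} => @chernoff Q (fun p q h1 h2 h3 => hQ p q h1 h2.le h3) hlim s t
  have hU1 : ∀ s t, S ≤ s → s ≤ t → t ≤ T → ‖U s t‖ ≤ 1 := fun s t hs hst ht => by
    rcases hst.eq_or_lt with rfl | hlt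
    · rw [hU.refl s ⟨hs, ht⟩]
      exact ContinuousLinearMap.norm_id_le
    · refine norm_le_one_of_tendsto (fun n => ?_) (hQU hs hst ht (uniformPartition hlt)
        (tendsto_mesh_uniformPartition hlt))
      refine norm_list_prod_le_one _ fun X hX => ?_
      obtain ⟨j, rfl⟩ := (List.mem_ofFn' _ _).1 hX
      exact hQ _ _ (hs.trans (TimePartition.le_pts _ _)) (TimePartition.lt_succ _ j).le
        ((TimePartition.pts_le _ _).trans ht)
  -- the semigroups are limits of powers of the propagator
  have hUG := fun (t : ℝ) (ht : t ∈ Ioc S T) {c : ℝ} (hc : 0 < c) (hct : S ≤ t - c) =>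
    tendsto_pow_semigroup (hgen t ⟨ht.1.le, ht.2⟩) (hclosed t ⟨ht.1.le, ht.2⟩)
      (hdom t ⟨ht.1.le, ht.2⟩) (hleft t ht) (fun s hs hst => hU1 s t hs hst ht.2) hc hct
  have hquot : ∀ (t : ℝ) {c : ℝ} (n : ℕ), 0 < c → S ≤ t - c →
      S ≤ t - c / (n + 1) ∧ t - c / (n + 1) < t := fun t c n hc hct => by
    have h1 : c / (n + 1) ≤ c := div_le_self hc.le (by linarith [n.cast_nonneg (α := ℝ)])
    have h2 : 0 < c / (n + 1) := by positivity
    exact ⟨by linarith, by linarith⟩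
  have hG1 : ∀ t ∈ Ioc S T, ∀ c, ‖G t c‖ ≤ 1 := fun t ht c => by
    have hsg := (hgen t ⟨ht.1.le, ht.2⟩).semigroup
    rcases eq_or_ne c 0 with rfl | hc
    · rw [hsg.zero]
      exact ContinuousLinearMap.norm_id_le
    obtain ⟨n, d, hd, hdt, rfl⟩ := exists_nsmul_small (pos_iff_ne_zero.2 hc) (sub_pos.2 ht.1)
    rw [hsg.map_nsmul]
    refine norm_pow_le_one ?_ _
    have h1 := norm_le_one_of_tendsto (fun n => norm_pow_le_one
      (hU1 _ _ (hquot t n hd (by linarith)).1 (hquot t n hd (by linarith)).2.le ht.2) _)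
      (hUG t ht hd (by linarith))
    rwa [Real.toNNReal_coe] at h1
  -- the propagator is a limit of products of the semigroups
  have hGU := fun {s t : ℝ} => @chernoff (fun p q => G q (q - p).toNNReal)
    (fun p q h1 h2 h3 => hG1 q ⟨h1.trans_lt h2, h3⟩ _)
    (fun y ε hε => by
      simp only [sub_sub_cancel]
      exact semigroup_quotient_uniform L hidense a (inv_pos.2 hγ).le haγ hcontA G
        (fun τ hτ => (hgen τ ⟨hτ.1.le, hτ.2⟩).semigroup) hG1
        (fun τ hτ => hGd τ ⟨hτ.1.le, hτ.2⟩) y hε) s t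
  -- `U s t` is a strong limit of products of the semigroups, all of which commute with `G r b`.
  have hcommU : ∀ s t, S ≤ s → s < t → t ≤ T → ∀ r ∈ Icc S T, ∀ b, Commute (U s t) (G r b) :=
    fun s t hs hst ht r hr b => by
      refine commute_of_tendsto (hGU hs hst.le ht (uniformPartition hst)
        (tendsto_mesh_uniformPartition hst)) fun n => ?_
      refine (Commute.list_prod_right _ _ fun X hX => ?_).symm
      obtain ⟨j, rfl⟩ := (List.mem_ofFn' _ _).1 hX
      exact hcomm r hr _ ⟨hs.trans (TimePartition.le_pts _ _),
        (TimePartition.pts_le _ _).trans ht⟩ _ _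
  intro s t hs hst ht
  have hsub : Icc s t ⊆ Icc S T := Icc_subset_Icc hs ht
  set B := integralOp A (LinearMap.range i) s t
  have hBdom : B.domain = LinearMap.range i := by
    refine le_antisymm (fun x hx => hx.1) ?_
    rintro _ ⟨y, rfl⟩
    refine ⟨⟨y, rfl⟩, fun r hr => hidom r ?_ y, ?_⟩
    · rw [uIcc_of_le hst] at hr
      exact hsub hr
    · refine ContinuousOn.intervalIntegrable ((hcontA y).mono ?_)
      rw [uIcc_of_le hst]
      exact hsub
  have hBdense : Dense (B.domain : Set E) := by
    rw [hBdom]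
    exact hidense
  have hBgraph : ∀ p, p ∈ B.graph ↔ ∃ y, p = (i y, ∫ r in s..t, a r y) := fun p => by
    rw [LinearPMap.mem_graph_iff]
    constructor
    · rintro ⟨x, h1, h2⟩
      obtain ⟨y, hy⟩ : (x : E) ∈ LinearMap.range i := hBdom ▸ x.2
      refine ⟨y, Prod.ext (h1.symm.trans hy.symm) (h2.symm.trans ?_)⟩
      change ∫ r in s..t, ap (A r) (x : E) = _
      rw [← hy]
    · rintro ⟨y, rfl⟩
      exact ⟨⟨i y, hBdom ▸ LinearMap.mem_range_self i y⟩, rfl, rfl⟩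
  refine ⟨hBdom, ?_⟩
  -- With `V 1 = U s t` the product formula is already known; the last two conditions are what the
  -- core criterion needs.
  suffices H : ∃ V : ℝ≥0 → E →L[𝕜] E, IsC0Semigroup V ∧ (∀ c, ‖V c‖ ≤ 1) ∧ V 1 = U s t ∧
      (∀ p ∈ B.graph, HasDerivAtZero V p.1 p.2) ∧
      ∀ c, V c ∈ graphStabilizer B.graph.topologicalClosure by
    obtain ⟨V, hV, hV1, hVU, hVd, hVinv⟩ := H
    obtain ⟨h1, h2⟩ := isGenerator_closure hV hV1 B hBdense hVd hVinv
    refine ⟨h1, V, h2, fun P hP x => ?_⟩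
    rw [hVU]
    exact hQU hs hst ht P hP x
  rcases hst.eq_or_lt with rfl | hlt
  · refine ⟨fun _ => 1, isC0Semigroup_one, fun _ => ContinuousLinearMap.norm_id_le,
      (hU.refl s ⟨hs, ht⟩).symm, fun p hp => ?_, fun _ => one_mem _⟩
    obtain ⟨y, rfl⟩ := (hBgraph p).1 hp
    rw [intervalIntegral.integral_same]
    exact hasDerivAtZero_one _
  have hmem : ∀ n (j : Fin (n + 1)), (uniformPartition hlt n).pts j.succ ∈ Ioc S T := fun n j =>
    ⟨(hs.trans (TimePartition.le_pts _ _)).trans_lt (TimePartition.lt_succ (uniformPartition hlt n) j),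
      (TimePartition.pts_le _ _).trans ht⟩
  have hmem' : ∀ n (j : Fin (n + 1)), (uniformPartition hlt n).pts j.succ ∈ Icc S T := fun n j =>
    ⟨(hmem n j).1.le, (hmem n j).2⟩
  -- Each semigroup is sped up by the length of its interval. Then `W n 1` is the product of the `G
  -- q (q - p)` over the partition, and the derivative of `W n` at zero is a Riemann sum.
  let c : (n : ℕ) → Fin (n + 1) → ℝ≥0 := fun n j =>
    ((uniformPartition hlt n).pts j.succ - (uniformPartition hlt n).pts j.castSucc).toNNReal
  let F : (n : ℕ) → Fin (n + 1) → ℝ≥0 → E →L[𝕜] E := fun n j b =>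
    G ((uniformPartition hlt n).pts j.succ) (b * c n j)
  have hF := fun n => semigroup_prod (F n)
    (fun j => (hgen _ (hmem' n j)).semigroup.rescale (c n j)) (fun j b => hG1 _ (hmem n j) _)
    (fun j k b d => hcomm _ (hmem' n j) _ (hmem' n k) _ _)
  let W : ℕ → ℝ≥0 → E →L[𝕜] E := fun n b => (List.ofFn fun j => F n j b).prod
  have hWcomm : ∀ n b (X : E →L[𝕜] E), (∀ r ∈ Icc S T, ∀ d, Commute X (G r d)) →
      Commute X (W n b) := fun n b X hX => by
    refine Commute.list_prod_right _ _ fun Z hZ => ?_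
    obtain ⟨j, rfl⟩ := (List.mem_ofFn' _ _).1 hZ
    exact hX _ (hmem' n j) _
  obtain ⟨V, hV, hV1, hVlim, hVd⟩ := exists_limit_semigroup W (fun n => (hF n).1)
    (fun n => (hF n).2.1)
    (fun n m b d => hWcomm m d _ fun r hr e => (hWcomm n b _ fun q hq f => hcomm r hr q hq e f).symm)
    (D := range i) hidense (fun x => ∫ r in s..t, ap (A r) x)
    (fun n x => ∑ j, (c n j : ℝ) • ap (A ((uniformPartition hlt n).pts j.succ)) x)
    (fun n x hx => by
      obtain ⟨y, rfl⟩ := hx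
      exact (hF n).2.2 _ _ fun j =>
        (hGd _ (hmem' n j) y).rescale (hgen _ (hmem' n j)).semigroup (c n j))
    (fun x hx => by
      obtain ⟨y, rfl⟩ := hx
      refine (tendsto_riemannSum hst ((hcontA y).mono hsub) _
        (tendsto_mesh_uniformPartition hlt)).congr fun n => ?_
      refine Finset.sum_congr rfl fun j _ => ?_
      congr 1
      exact (Real.coe_toNNReal _ (sub_pos.2 (TimePartition.lt_succ _ j)).le).symm)
  have hVgraph : ∀ p ∈ B.graph, HasDerivAtZero V p.1 p.2 := fun p hp => by
    obtain ⟨y, rfl⟩ := (hBgraph p).1 hp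
    exact hVd _ ⟨y, rfl⟩
  refine ⟨V, hV, hV1, ?_, hVgraph, ?_⟩
  · ext x
    refine tendsto_nhds_unique (hVlim 1 x) ?_
    refine (hGU hs hst ht _ (tendsto_mesh_uniformPartition hlt) x).congr fun n => ?_
    simp only [W, F, one_mul]
    rfl
  -- invariance of the closure of the graph
  have hinvU : ∀ p q, S ≤ p → p < q → q ≤ T → U p q ∈ graphStabilizer B.graph := by
    intro p q hp hpq hq e he
    have h1 := hVgraph e he
    obtain ⟨y, rfl⟩ := (hBgraph e).1 he
    obtain ⟨z, hz⟩ := hinv p q hp hpq hq y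
    -- `V` commutes with `U p q`, so the derivative of its orbit at `U p q (i y) = i z` is the image
    -- of the derivative at `i y`; by uniqueness it is also the integral operator at `z`.
    have h2 := h1.map (X := U p q) fun b => commute_of_tendsto (hVlim b) fun n =>
      (hWcomm n b _ (hcommU p q hp hpq hq)).symm
    have h3 := hVgraph _ ((hBgraph _).2 ⟨z, rfl⟩)
    refine (hBgraph _).2 ⟨z, Prod.ext hz.symm ?_⟩
    simp only [hz] at h3
    exact tendsto_nhds_unique h2 h3
  have hΓ := B.graph.isClosed_topologicalClosure
  have hinvG : ∀ r ∈ Ioc S T, ∀ b, G r b ∈ graphStabilizer B.graph.topologicalClosure := by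
    intro r hr b
    have hsg := (hgen r ⟨hr.1.le, hr.2⟩).semigroup
    rcases eq_or_ne b 0 with rfl | hb
    · rw [hsg.zero]
      exact one_mem _
    obtain ⟨n, d, hd, hdt, rfl⟩ := exists_nsmul_small (pos_iff_ne_zero.2 hb) (sub_pos.2 hr.1)
    rw [hsg.map_nsmul]
    refine pow_mem ?_ _
    -- `G r d` is a strong limit of powers of `U`. The limit may leave the graph, so invariance
    -- passes only to its closure.
    have h1 := mem_graphStabilizer_of_tendsto hΓ (hUG r hr hd (by linarith)) fun n => pow_mem
      (mem_graphStabilizer_topologicalClosure (hinvU _ _ (hquot r n hd (by linarith)).1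
        (hquot r n hd (by linarith)).2 hr.2)) _
    rwa [Real.toNNReal_coe] at h1
  intro b
  refine mem_graphStabilizer_of_tendsto hΓ (hVlim b) fun n => list_prod_mem fun X hX => ?_
  obtain ⟨j, rfl⟩ := (List.mem_ofFn' _ _).1 hX
  exact hinvG _ (hmem n j) _
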